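/- Let $V$ be a finite set, $\beta\in(0,1)$, and $\eta=(\eta_i)_{i\in V}$ a probability vector with $\eta_i>0$ for all $i$. Consider the centrality game $\Gamma(V,\beta,\eta,2\cdot\mathbf 1)$: each player $i\in V$ chooses a set $x_i\subseteq V\setminus\{i\}$ of exactly two nodes. A configuration $x=(x_i)_{i\in V}$ determines the directed graph $\mathcal G(x)$ with node set $V$ and a link $(i,j)$ for all $i\in V$, $j\in x_i$, and the matrix $R(x)$ with entries $R_{ij}=\frac12$ if $j\in x_i$ and $R_{ij}=0$ otherwise; the utility of player $i$ is the PageRank centrality $u_i(x)=\pi_i(x)$, where $\pi(x)=(1-\beta)(I-\beta R(x)^\top)^{-1}\eta$. The best response set $\mathcal B_i(x_{-i})$ is the set of actions of player $i$ that maximize her utility when the others play $x_{-i}$. A configuration $x$ is a Nash equilibrium if $x_i\in\mathcal B_i(x_{-i})$ for all $i$, and a strict one if $\mathcal B_i(x_{-i})=\{x_i\}$ for all $i$. A best response path is a finite sequence of configurations (possibly of length $0$), each of which differs from the preceding one $x$ in the action of exactly one player $i$, whose new action lies in $\mathcal B_i(x_{-i})$. A configuration $x$ is recursive if for every configuration $y\neq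 x$ to which there is a best response path from $x$ there is also a best response path from $y$ to $x$. For $k\ge 3$ the ring $R_k$ is the cycle on $k$ nodes with links in both directions. The butterfly graph $B_5$ has nodes $1,\dots,5$; node $1$ links to $2$ and $4$; nodes $2$ and $3$ link to each other and to $1$; nodes $4$ and $5$ link to each other and to $1$. Up to isomorphism, let * $\mathcal R$ be the family of disjoint unions of rings $R_k$ with $k\ge3$ (the lengths $k$ may differ); * $\mathcal K_{3,2}$ be the family of graphs that consist of a disjoint union of rings $R_3$ and of two further nodes $r,s$ that link to each other, that receive no other link, and each of which has exactly one further out-link, to an arbitrary node of the rings; * $\mathcal K_{3,\mathcal B}$ be the family of disjoint unions of one butterfly graph $B_5$ and of any number (possibly zero) of rings $R_3$. **Theorem.** For every configuration $x$ of $\Gamma(V,\beta,\eta,2\cdot\mathbf 1)$: 1. $x$ is a strict Nash equilibrium if and only if $\mathcal G(x)\in\mathcal R$; 2. $x$ is a recursive Nash equilibrium (that is, a Nash equilibrium that is recursive) if and only if $\mathcal G(x)\in\mathcal R\cup\mathcal K_{3,2}\cup\mathcal K_{3,\mathcal B}$. -/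

import Mathlib

open scoped Matrix

/-! ### Finite games: best responses, Nash equilibria, best response paths -/

namespace Game

variable {V : Type*} [DecidableEq V] {A : V → Type*}

/-- The best response set `B_i(x_{-i})` of player `i`, for the utilities `u`. It depends on `x`
only through the actions of the players other than `i`. -/
def bestResponses (u : V → (∀ i, A i) → ℝ) (i : V) (x : ∀ i, A i) : Set (A i) :=
  {a | ∀ b : A i, u i (Function.update x i b) ≤ u i (Function.update x i a)}

/-- (Pure strategy) Nash equilibrium. -/
def IsNash (u : V → (∀ i, A i) → ℝ) (x : ∀ i, A i) : Prop :=
  ∀ i, x i ∈ bestResponses u i x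

/-- Strict Nash equilibrium: every player is playing her unique best response. -/
def IsStrictNash (u : V → (∀ i, A i) → ℝ) (x : ∀ i, A i) : Prop :=
  ∀ i, bestResponses u i x = {x i}

/-- `(x, y)` is a best response path of length one: `y ≠ x` is obtained from `x` by letting one
player switch to one of her best responses. -/
def BestResponseStep (u : V → (∀ i, A i) → ℝ) (x y : ∀ i, A i) : Prop :=
  y ≠ x ∧ ∃ i, y i ∈ bestResponses u i x ∧ ∀ j, j ≠ i → y j = x j

/-- There is a best response path, of some length `l ≥ 0`, from `x` to `y`. -/
def BestResponsePath (u : V → (∀ i, A i) → ℝ) (x y : ∀ i, A i) : Prop :=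
  Relation.ReflTransGen (BestResponseStep u) x y

/-- A configuration `x` is recursive if every other configuration that can be reached from `x`
by a best response path also has a best response path back to `x`. -/
def IsRecursive (u : V → (∀ i, A i) → ℝ) (x : ∀ i, A i) : Prop :=
  ∀ y, y ≠ x → BestResponsePath u x y → BestResponsePath u y x

end Game

/-! ### Centrality games -/

namespace CentralityGame

section

variable {V : Type*}

/-- The actions of player `i`: the sets of `d i` nodes other than `i`. -/
abbrev Action (d : V → ℕ) (i : V) : Type _ :=
  {a : Finset V // i ∉ a ∧ a.card = d i}

/-- Configurations `x = (x_i)_{i ∈ V}`. -/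
abbrev Config (d : V → ℕ) : Type _ := ∀ i, Action d i

/-- The directed graph `G(x)`, with a link from `i` to every `j ∈ x_i`. -/
def graph {d : V → ℕ} (x : Config d) : Digraph V where
  Adj i j := j ∈ (x i).1

variable [DecidableEq V]

/-- The normalized adjacency matrix `R(x)`. -/
noncomputable def normAdj {d : V → ℕ} (x : Config d) : Matrix V V ℝ :=
  Matrix.of fun i j => if j ∈ (x i).1 then 1 / (d i : ℝ) else 0

variable [Fintype V]

/-- The PageRank centrality vector `π(x) = (1 - β) (I - β R(x)ᵀ)⁻¹ η`. -/
noncomputable def pageRank {d : V → ℕ} (β : ℝ) (η : V → ℝ) (x : Config d) : V → ℝ :=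
  (1 - β) • ((1 - β • (normAdj x)ᵀ)⁻¹ *ᵥ η)

/-- The utilities of the centrality game `Γ(V, β, η, d)`: the utility of player `i` is her own
PageRank centrality. -/
noncomputable def utility (d : V → ℕ) (β : ℝ) (η : V → ℝ) (i : V) (x : Config d) : ℝ :=
  pageRank β η x i

end

end CentralityGame

/-! ### The graph families -/

namespace Digraph

/-- Two directed graphs are isomorphic if they differ by a relabeling of the nodes. -/
def Isomorphic {V W : Type*} (G : Digraph V) (H : Digraph W) : Prop :=
  Nonempty (G.Adj ≃r H.Adj)

/-- The links of a disjoint union: a link joins two nodes of the same summand `G a`, as there. -/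
inductive DisjointUnionAdj {ι : Type*} {W : ι → Type*} (G : ∀ a, Digraph (W a)) :
    (Σ a, W a) → (Σ a, W a) → Prop
  | mk (a : ι) (v w : W a) (h : (G a).Adj v w) : DisjointUnionAdj G ⟨a, v⟩ ⟨a, w⟩

/-- Disjoint union of a family of directed graphs. -/
def disjointUnion {ι : Type*} {W : ι → Type*} (G : ∀ a, Digraph (W a)) : Digraph (Σ a, W a) where
  Adj := DisjointUnionAdj G

/-- Disjoint union of two directed graphs. -/
def disjointSum {V W : Type*} (G : Digraph V) (H : Digraph W) : Digraph (V ⊕ W) where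
  Adj := Sum.LiftRel G.Adj H.Adj

/-- The ring graph `R_k` (`k ≥ 3`), every link of which is undirected. -/
def ring (k : ℕ) : Digraph (Fin k) where
  Adj := (SimpleGraph.cycleGraph k).Adj

/-- The disjoint union of `m` copies of the ring graph `R_3`. -/
def threeRings (m : ℕ) : Digraph (Σ _ : Fin m, Fin 3) :=
  disjointUnion fun _ => ring 3

/-- The butterfly graph `B_5`: node `0` links to `1` and `3`; nodes `1` and `2` link to each other
and to `0`; nodes `3` and `4` link to each other and to `0`. -/
def butterfly : Digraph (Fin 5) where
  Adj i j := j ∈ (![{1, 3}, {0, 2}, {0, 1}, {0, 4}, {0, 3}] : Fin 5 → Finset (Fin 5)) i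

/-- The directed graph made of `m` disjoint rings `R_3` and of a `2`-clique, whose nodes `0` and `1`
have besides one further link each, to the nodes `t 0` and `t 1` of the rings. (No link enters the
clique, so that it is a source component.) -/
def cliqueSource (m : ℕ) (t : Fin 2 → Σ _ : Fin m, Fin 3) :
    Digraph (Fin 2 ⊕ (Σ _ : Fin m, Fin 3)) where
  Adj
    | .inl a, .inl b => a ≠ b
    | .inl a, .inr q => q = t a
    | .inr _, .inl _ => False
    | .inr p, .inr q => (threeRings m).Adj p q

variable {V : Type*}

/-- The family `𝓡`: disjoint unions of ring graphs `R_k` with `k ≥ 3`. -/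
def IsRingUnion (G : Digraph V) : Prop :=
  ∃ (m : ℕ) (k : Fin m → ℕ), (∀ a, 3 ≤ k a) ∧ G.Isomorphic (disjointUnion fun a => ring (k a))

/-- The family `𝓚_{3,2}`: disjoint unions of `3`-rings together with a unique `2`-clique source
component, each of whose two nodes has one further out-link, to an arbitrary node of the rings. -/
def IsThreeRingsWithCliqueSource (G : Digraph V) : Prop :=
  ∃ (m : ℕ) (t : Fin 2 → Σ _ : Fin m, Fin 3), G.Isomorphic (cliqueSource m t)

/-- The family `𝓚_{3,𝓑}`: disjoint unions of (possibly zero) `3`-rings and of a unique butterfly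
graph. -/
def IsThreeRingsWithButterfly (G : Digraph V) : Prop :=
  ∃ m : ℕ, G.Isomorphic (disjointSum (threeRings m) butterfly)

end Digraph

/-! Let `h_i(k)` be the discounted probability that the walk from `k` hits `i`. The walk is stopped
at `i`, so `h_i` does not depend on the action of `i`, and the PageRank of `i` is `(1-β) Σ h_i(k)
η_k / (1 - β/2 Σ_{m ∈ x_i} h_i(m))`. Hence `i` plays a best response exactly when she links to two
nodes with the largest values of `h_i` (`mem_bestResponses_iff`); `η` no longer matters. No node
other than `i` exceeds `β/(2-β)`, a value attained by two nodes that link to each other and to `i`.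

Strict equilibria are the configurations whose links are all undirected. In such a configuration the
two neighbours of a node have equal value (`hit_eq_of_isMutual`) and strictly beat all others.
Conversely, in a Nash equilibrium a link without reverse starts at a source or is a shortcut
(`isShortcutCore_of_isNash`), and both give some player a second best response.

For recursion, call a configuration recurrent if it is undirected, or consists of triangles with a
source clique or with a butterfly. Recurrent configurations are Nash and stable under best
responses: the only change of shape occurs when both clique nodes point to the same node `c`, which
is then indifferent among all its in-neighbours, so that cliques and butterflies turn into each
other. A best response step that leaves a Nash equilibrium can be undone, hence recurrent
configurations are recursive.

Conversely, every Nash equilibrium has a best response path to a recurrent configuration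
(`exists_path_of_isNash`): a set `R` of triangles grows by absorbing shortcuts and nodes with few
in-links, while sources redirect their links into `R`. If the equilibrium is recursive, the path
leads back, and stability makes the equilibrium itself recurrent. -/

namespace CentralityGame

/-! ### Discounted hitting probabilities -/

variable {V : Type*}

/-- Configurations in which every player sets two links. -/
abbrev Config₂ (V : Type*) : Type _ := Config (fun _ : V => 2)

theorem notMem_links (x : Config₂ V) (i : V) : i ∉ (x i).1 := (x i).2.1

theorem card_links (x : Config₂ V) (i : V) : (x i).1.card = 2 := (x i).2.2

theorem ne_of_mem_links {x : Config₂ V} {i j : V} (h : j ∈ (x i).1) : j ≠ i := by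
  rintro rfl; exact notMem_links x j h

variable [DecidableEq V]

theorem links_eq_pair {x : Config₂ V} {i p q : V} (hp : p ∈ (x i).1) (hq : q ∈ (x i).1)
    (hpq : p ≠ q) : (x i).1 = {p, q} := by
  symm
  apply Finset.eq_of_subset_of_card_le
  · intro k hk
    simp only [Finset.mem_insert, Finset.mem_singleton] at hk
    rcases hk with rfl | rfl <;> assumption
  · rw [card_links, Finset.card_pair hpq]

theorem exists_other {x : Config₂ V} {i p : V} (hp : p ∈ (x i).1) :
    ∃ q, q ≠ p ∧ (x i).1 = {p, q} := by
  obtain ⟨a, b, hab, h⟩ := Finset.card_eq_two.1 (card_links x i)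
  rw [h] at hp ⊢
  simp only [Finset.mem_insert, Finset.mem_singleton] at hp
  rcases hp with rfl | rfl
  · exact ⟨b, hab.symm, rfl⟩
  · exact ⟨a, hab, Finset.pair_comm _ _⟩

theorem exists_links_eq (x : Config₂ V) (i : V) : ∃ p q, p ≠ q ∧ (x i).1 = {p, q} :=
  Finset.card_eq_two.1 (card_links x i)

variable [Fintype V]

/-- The linear system solved by the discounted hitting probabilities of node `i`. -/
noncomputable def hitMatrix (β : ℝ) (x : Config₂ V) (i : V) : Matrix V V ℝ :=
  Matrix.of fun k m => (if k = m then 1 else 0) - if k ≠ i ∧ m ∈ (x k).1 then β / 2 else 0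

/-- The discounted probability that the random walk on `G(x)` started at `k` hits node `i`. -/
noncomputable def hit (β : ℝ) (x : Config₂ V) (i : V) : V → ℝ :=
  (hitMatrix β x i)⁻¹ *ᵥ Pi.single i 1

variable {β : ℝ}

theorem sum_ite_links (x : Config₂ V) (k : V) (c : ℝ) (f : V → ℝ) :
    ∑ m, (if m ∈ (x k).1 then c else 0) * f m = c * ∑ m ∈ (x k).1, f m := by
  simp [ite_mul, Finset.sum_ite_mem, Finset.mul_sum]

/-- Strict diagonal dominance: the diagonal is `1`, and the other entries of a row have absolute sum
at most `β < 1`. -/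
theorem det_hitMatrix_ne_zero (hβ : β ∈ Set.Ioo (0 : ℝ) 1) (x : Config₂ V) (i : V) :
    (hitMatrix β x i).det ≠ 0 := by
  apply det_ne_zero_of_sum_row_lt_diag
  intro k
  have hb : 0 ≤ β / 2 := by linarith [hβ.1]
  have hb' : |β| = β := abs_of_pos hβ.1
  have hd : hitMatrix β x i k k = 1 := by simp [hitMatrix, notMem_links]
  rw [hd, norm_one]
  have : ∀ m ∈ Finset.univ.erase k, ‖hitMatrix β x i k m‖ ≤
      (if m ∈ (x k).1 then β / 2 else 0) * 1 := by
    intro m hm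
    have hkm : k ≠ m := (Finset.ne_of_mem_erase hm).symm
    simp only [hitMatrix, Matrix.of_apply, hkm, if_false, zero_sub, norm_neg, mul_one]
    split_ifs <;> simp_all [abs_of_pos]
  calc _ ≤ ∑ m ∈ Finset.univ.erase k, (if m ∈ (x k).1 then β / 2 else 0) * (1 : ℝ) :=
        Finset.sum_le_sum this
    _ ≤ ∑ m, (if m ∈ (x k).1 then β / 2 else 0) * (1 : ℝ) := by
        apply Finset.sum_le_sum_of_subset_of_nonneg (Finset.subset_univ _)
        intro m _ _
        split_ifs <;> simp [hb]
    _ = β := by rw [sum_ite_links x k _ (fun _ => 1)]; simp [card_links]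
    _ < 1 := hβ.2

theorem hitMatrix_mulVec_hit (hβ : β ∈ Set.Ioo (0 : ℝ) 1) (x : Config₂ V) (i : V) :
    hitMatrix β x i *ᵥ hit β x i = Pi.single i 1 := by
  rw [hit, Matrix.mulVec_mulVec, Matrix.mul_nonsing_inv _ (det_hitMatrix_ne_zero hβ x i).isUnit,
    Matrix.one_mulVec]

theorem hitMatrix_mulVec (x : Config₂ V) (i : V) (f : V → ℝ) (k : V) :
    (hitMatrix β x i *ᵥ f) k = f k - if k = i then 0 else β / 2 * ∑ m ∈ (x k).1, f m := by
  simp only [hitMatrix, Matrix.mulVec, dotProduct, Matrix.of_apply, sub_mul,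
    Finset.sum_sub_distrib]
  congr 1
  · simp
  · split_ifs with h
    · simp [h]
    · rw [← sum_ite_links]; simp [h]

theorem hit_self (hβ : β ∈ Set.Ioo (0 : ℝ) 1) (x : Config₂ V) (i : V) : hit β x i i = 1 := by
  have := congrFun (hitMatrix_mulVec_hit hβ x i) i
  rw [hitMatrix_mulVec] at this
  simpa using this

theorem hit_eq_sum (hβ : β ∈ Set.Ioo (0 : ℝ) 1) (x : Config₂ V) {i k : V} (hk : k ≠ i) :
    hit β x i k = β / 2 * ∑ m ∈ (x k).1, hit β x i m := by
  have := congrFun (hitMatrix_mulVec_hit hβ x i) k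
  rw [hitMatrix_mulVec] at this
  simp only [hk, if_false, Pi.single_apply] at this
  linarith

theorem hit_eq_pair (hβ : β ∈ Set.Ioo (0 : ℝ) 1) {x : Config₂ V} {i k p q : V} (hk : k ≠ i)
    (h : (x k).1 = {p, q}) :
    hit β x i k = β / 2 * (hit β x i p + hit β x i q) := by
  have hpq : p ≠ q := by
    rintro rfl
    have := card_links x k
    simp [h] at this
  rw [hit_eq_sum hβ x hk, h, Finset.sum_pair hpq]

omit [DecidableEq V] in
/-- Maximum principle. -/
theorem le_of_harmonic (hβ : β ∈ Set.Ioo (0 : ℝ) 1) (x : Config₂ V) (S : Set V) (f : V → ℝ) (c : ℝ)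
    (hc : 0 ≤ c) (hf : ∀ k ∈ S, f k = β / 2 * ∑ m ∈ (x k).1, f m)
    (hS : ∀ k ∈ S, ∀ m ∈ (x k).1, m ∈ S ∨ f m ≤ c) : ∀ k ∈ S, f k ≤ c := by
  intro k hk
  -- At a maximizer `a` with `f a > c ≥ 0`, all targets have value at most `f a`, so `f a ≤ β * f
  -- a`, which is absurd.
  obtain ⟨a, haS, ha⟩ := Set.exists_max_image S f (Set.toFinite S) ⟨k, hk⟩
  refine (ha k hk).trans ?_
  by_contra! hac
  have : ∑ m ∈ (x a).1, f m ≤ ∑ m ∈ (x a).1, f a := by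
    apply Finset.sum_le_sum
    intro m hm
    rcases hS a haS m hm with h | h
    · exact ha m h
    · linarith
  rw [Finset.sum_const, card_links, nsmul_eq_mul] at this
  have h1 := hf a haS
  have h2 := hβ.1
  have h3 := hβ.2
  push_cast at this
  nlinarith

theorem hit_le_of_closed (hβ : β ∈ Set.Ioo (0 : ℝ) 1) {x : Config₂ V} {i : V} (S : Set V) {c : ℝ}
    (hc : 0 ≤ c) (hi : i ∉ S)
    (hS : ∀ k ∈ S, ∀ m ∈ (x k).1, m ∈ S ∨ hit β x i m ≤ c) : ∀ k ∈ S, hit β x i k ≤ c :=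
  le_of_harmonic hβ x S _ c hc (fun _ hk => hit_eq_sum hβ x (fun h => hi (h ▸ hk))) hS

theorem hit_nonneg (hβ : β ∈ Set.Ioo (0 : ℝ) 1) (x : Config₂ V) (i k : V) : 0 ≤ hit β x i k := by
  by_cases hk : k = i
  · rw [hk, hit_self hβ]; norm_num
  have := le_of_harmonic hβ x {k | k ≠ i} (fun k => - hit β x i k) 0 le_rfl
    (fun k hk => by rw [hit_eq_sum hβ x hk]; simp)
    (fun k _ m _ => by
      by_cases h : m = i
      · right; rw [h, hit_self hβ]; norm_num
      · left; exact h) k hk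
  simpa using this

theorem hit_eq_zero_of_closed (hβ : β ∈ Set.Ioo (0 : ℝ) 1) {x : Config₂ V} {i : V} (S : Set V)
    (hi : i ∉ S) (hS : ∀ k ∈ S, ∀ m ∈ (x k).1, m ∈ S) {k : V} (hk : k ∈ S) : hit β x i k = 0 :=
  le_antisymm (hit_le_of_closed hβ S le_rfl hi (fun k hk m hm => Or.inl (hS k hk m hm)) k hk)
    (hit_nonneg hβ x i k)

/-- Hitting probabilities within a closed set depend only on the links there. -/
theorem hit_congr (hβ : β ∈ Set.Ioo (0 : ℝ) 1) {x y : Config₂ V} {i : V} (S : Set V)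
    (hxy : ∀ k ∈ S, k ≠ i → x k = y k) (hS : ∀ k ∈ S, k ≠ i → ∀ m ∈ (x k).1, m ∈ S)
    {k : V} (hk : k ∈ S) : hit β x i k = hit β y i k := by
  by_cases hki : k = i
  · rw [hki, hit_self hβ, hit_self hβ]
  -- Applied to the difference of the two hitting vectors with either sign.
  have key : ∀ g : V → ℝ, g i = 0 → (∀ k ∈ S, k ≠ i → g k = β / 2 * ∑ m ∈ (x k).1, g m) →
      g k ≤ 0 := by
    intro g hg0 hg
    refine le_of_harmonic hβ x {k | k ∈ S ∧ k ≠ i} g 0 le_rfl (fun k hk => hg k hk.1 hk.2) ?_ k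
      ⟨hk, hki⟩
    intro k hk m hm
    by_cases h : m = i
    · right; rw [h, hg0]
    · left; exact ⟨hS k hk.1 hk.2 m hm, h⟩
  have h1 := key (fun k => hit β x i k - hit β y i k) (by simp [hit_self hβ]) (by
    intro k hk hki
    rw [hit_eq_sum hβ x hki, hit_eq_sum hβ y hki, hxy k hk hki, Finset.sum_sub_distrib, mul_sub])
  have h2 := key (fun k => hit β y i k - hit β x i k) (by simp [hit_self hβ]) (by
    intro k hk hki
    rw [hit_eq_sum hβ x hki, hit_eq_sum hβ y hki, hxy k hk hki, Finset.sum_sub_distrib, mul_sub])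
  linarith

/-- The largest possible hitting probability of another node. -/
theorem hit_le_max (hβ : β ∈ Set.Ioo (0 : ℝ) 1) (x : Config₂ V) {i k : V} (hk : k ≠ i) :
    hit β x i k ≤ β / (2 - β) := by
  -- At most one of the two targets of a maximizer `a` is `i`, whose value is `1`. So the maximum
  -- satisfies `M ≤ β/2 * (1 + M)`, that is `M ≤ β/(2-β)`.
  obtain ⟨a, haS, ha⟩ := Set.exists_max_image {k | k ≠ i} (hit β x i) (Set.toFinite _) ⟨k, hk⟩
  refine (ha k hk).trans ?_
  have h1 := hβ.1
  have h2 := hβ.2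
  have h0 := hit_nonneg hβ x i a
  rw [le_div_iff₀ (by linarith)]
  obtain ⟨p, q, hpq, hx⟩ := exists_links_eq x a
  have he := hit_eq_pair hβ haS hx
  have aux : hit β x i a ≤ 1 → hit β x i p + hit β x i q ≤ 1 + hit β x i a := by
    intro h
    by_cases hp : p = i
    · rw [hp, hit_self hβ]
      have := ha q (fun h => hpq (hp.trans h.symm))
      linarith
    · have hp' := ha p hp
      by_cases hq : q = i
      · rw [hq, hit_self hβ]; linarith
      · have := ha q hq
        linarith
  have hle : hit β x i a ≤ 1 :=
    hit_le_of_closed hβ {k | k ≠ i} zero_le_one (by simp) (fun k _ m _ => by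
      by_cases h : m = i
      · right; rw [h, hit_self hβ]
      · left; exact h) a haS
  have := aux hle
  nlinarith

theorem hit_lt_one (hβ : β ∈ Set.Ioo (0 : ℝ) 1) (x : Config₂ V) {i k : V} (hk : k ≠ i) :
    hit β x i k < 1 := by
  have h1 := hβ.1
  have h2 := hβ.2
  refine (hit_le_max hβ x hk).trans_lt ?_
  rw [div_lt_one (by linarith)]
  linarith

theorem hit_le_one (hβ : β ∈ Set.Ioo (0 : ℝ) 1) (x : Config₂ V) (i k : V) :
    hit β x i k ≤ 1 := by
  by_cases hk : k = i
  · rw [hk, hit_self hβ]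
  · exact (hit_lt_one hβ x hk).le

/-- A node that attains the largest possible hitting probability links to the target and to
another such node. -/
theorem mem_of_hit_eq_max (hβ : β ∈ Set.Ioo (0 : ℝ) 1) {x : Config₂ V} {i k : V} (hk : k ≠ i)
    (h : hit β x i k = β / (2 - β)) :
    i ∈ (x k).1 ∧ ∀ m ∈ (x k).1, m ≠ i → hit β x i m = β / (2 - β) := by
  have h1 := hβ.1
  have h2 := hβ.2
  have hM : 0 < β / (2 - β) := div_pos h1 (by linarith)
  have hM' : β / (2 - β) * (2 - β) = β := div_mul_cancel₀ _ (by linarith)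
  have hi : i ∈ (x k).1 := by
    by_contra hi
    obtain ⟨p, q, hpq, hx⟩ := exists_links_eq x k
    have he := hit_eq_pair hβ hk hx
    have hp : p ≠ i := by rintro rfl; simp [hx] at hi
    have hq : q ≠ i := by rintro rfl; simp [hx] at hi
    have := hit_le_max hβ x hp
    have := hit_le_max hβ x hq
    nlinarith
  refine ⟨hi, fun m hm hmi => ?_⟩
  have he := hit_eq_pair hβ hk (links_eq_pair hi hm hmi.symm)
  rw [hit_self hβ, h] at he
  generalize β / (2 - β) = M at *
  have : β * (hit β x i m - M) = 0 := by linarith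
  rcases mul_eq_zero.1 this with h | h <;> linarith

theorem half_le_hit (hβ : β ∈ Set.Ioo (0 : ℝ) 1) {x : Config₂ V} {i k m : V} (hk : k ≠ i)
    (hm : m ∈ (x k).1) : β / 2 * hit β x i m ≤ hit β x i k := by
  obtain ⟨q, hq, hx⟩ := exists_other hm
  rw [hit_eq_pair hβ hk hx]
  have := hit_nonneg hβ x i q
  have := hβ.1
  nlinarith

theorem hit_pos (hβ : β ∈ Set.Ioo (0 : ℝ) 1) {x : Config₂ V} {i k : V} (h : i ∈ (x k).1) :
    0 < hit β x i k := by
  have := half_le_hit hβ (ne_of_mem_links h).symm h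
  rw [hit_self hβ] at this
  linarith [hβ.1]

theorem hit_pos_of_mem (hβ : β ∈ Set.Ioo (0 : ℝ) 1) {x : Config₂ V} {i k m : V} (hk : k ≠ i)
    (h : m ∈ (x k).1) (hm : 0 < hit β x i m) : 0 < hit β x i k := by
  have := half_le_hit hβ hk h
  have := hβ.1
  nlinarith

/-- The two other nodes of a triangle attain the largest possible hitting probability. -/
theorem hit_eq_max (hβ : β ∈ Set.Ioo (0 : ℝ) 1) {x : Config₂ V} {i p q : V}
    (hp : (x p).1 = {i, q}) (hq : (x q).1 = {i, p}) : hit β x i p = β / (2 - β) := by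
  have h1 := hβ.1
  have h2 := hβ.2
  have hpi : p ≠ i := by rintro rfl; exact notMem_links x p (by simp [hp])
  have hqi : q ≠ i := by rintro rfl; exact notMem_links x q (by simp [hq])
  have e1 := hit_eq_pair hβ hpi hp
  have e2 := hit_eq_pair hβ hqi hq
  rw [hit_self hβ] at e1 e2
  rw [eq_div_iff (by linarith)]
  have : (hit β x i p - hit β x i q) * (1 + β / 2) = 0 := by linarith
  rcases mul_eq_zero.1 this with h | h
  · have : hit β x i q = hit β x i p := by linarith
    rw [this] at e1
    linarith
  · linarith

end CentralityGame

/-! ### PageRank through hitting probabilities, and best responses -/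

namespace CentralityGame

variable {V : Type*} [DecidableEq V] [Fintype V] {β : ℝ} {η : V → ℝ}

/-- The rows of `normAdj x` sum to `1`, so after transposition the matrix is diagonally dominant by
rows. -/
theorem det_one_sub_ne_zero (hβ : β ∈ Set.Ioo (0 : ℝ) 1) (x : Config₂ V) :
    (1 - β • (normAdj x)ᵀ).det ≠ 0 := by
  rw [← Matrix.det_transpose]
  apply det_ne_zero_of_sum_row_lt_diag
  intro k
  have hb : 0 ≤ β / 2 := by linarith [hβ.1]
  have hb' : |β| = β := abs_of_pos hβ.1
  have hd : (1 - β • (normAdj x)ᵀ)ᵀ k k = 1 := by simp [normAdj, notMem_links]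
  rw [hd, norm_one]
  have : ∀ m ∈ Finset.univ.erase k, ‖(1 - β • (normAdj x)ᵀ)ᵀ k m‖ ≤
      (if m ∈ (x k).1 then β / 2 else 0) * 1 := by
    intro m hm
    have hkm : m ≠ k := Finset.ne_of_mem_erase hm
    simp only [normAdj, Matrix.transpose_apply, Matrix.sub_apply, Matrix.one_apply, hkm,
      Matrix.smul_apply, Matrix.of_apply, if_false]
    split_ifs <;> simp [hb', div_eq_mul_inv]
  calc _ ≤ ∑ m ∈ Finset.univ.erase k, (if m ∈ (x k).1 then β / 2 else 0) * (1 : ℝ) :=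
        Finset.sum_le_sum this
    _ ≤ ∑ m, (if m ∈ (x k).1 then β / 2 else 0) * (1 : ℝ) := by
        apply Finset.sum_le_sum_of_subset_of_nonneg (Finset.subset_univ _)
        intro m _ _
        split_ifs <;> simp [hb]
    _ = β := by rw [sum_ite_links x k _ (fun _ => 1)]; simp [card_links]
    _ < 1 := hβ.2

theorem pageRank_eq (hβ : β ∈ Set.Ioo (0 : ℝ) 1) (x : Config₂ V) (k : V) :
    (1 - β) * η k = pageRank β η x k - β * ((normAdj x)ᵀ *ᵥ pageRank β η x) k := by
  have h : (1 - β • (normAdj x)ᵀ) *ᵥ pageRank β η x = (1 - β) • η := by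
    rw [pageRank, Matrix.mulVec_smul, Matrix.mulVec_mulVec,
      Matrix.mul_nonsing_inv _ (det_one_sub_ne_zero hβ x).isUnit, Matrix.one_mulVec]
  have := congrFun h k
  simp only [Matrix.sub_mulVec, Matrix.one_mulVec, Matrix.smul_mulVec, Pi.sub_apply, Pi.smul_apply,
    smul_eq_mul] at this
  exact this.symm

/-- The PageRank equation is paired with the vector `hit β x i`. This vector is harmonic off `i`, so
all terms but that of `i` cancel. -/
theorem utility_mul_eq (hβ : β ∈ Set.Ioo (0 : ℝ) 1) (x : Config₂ V) (i : V) :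
    utility (fun _ => 2) β η i x * (1 - β / 2 * ∑ m ∈ (x i).1, hit β x i m) =
      (1 - β) * ∑ k, hit β x i k * η k := by
  have h1 : (1 - β) * ∑ k, hit β x i k * η k =
      ∑ k, (hit β x i k * pageRank β η x k -
        hit β x i k * (β * ((normAdj x)ᵀ *ᵥ pageRank β η x) k)) := by
    rw [Finset.mul_sum]
    refine Finset.sum_congr rfl fun k _ => ?_
    rw [← mul_sub, ← pageRank_eq hβ x k]
    ring
  have h2 : ∑ k, hit β x i k * (β * ((normAdj x)ᵀ *ᵥ pageRank β η x) k) =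
      ∑ k, (β / 2 * ∑ m ∈ (x k).1, hit β x i m) * pageRank β η x k := by
    simp only [Matrix.mulVec, dotProduct, Finset.mul_sum, Matrix.transpose_apply, normAdj,
      Matrix.of_apply]
    rw [Finset.sum_comm]
    refine Finset.sum_congr rfl fun k _ => ?_
    rw [Finset.sum_mul, ← Finset.sum_filter_add_sum_filter_not Finset.univ (· ∈ (x k).1)]
    rw [Finset.filter_mem_eq_inter, Finset.univ_inter]
    rw [Finset.sum_eq_zero (s := Finset.univ.filter (· ∉ (x k).1)), add_zero]
    · refine Finset.sum_congr rfl fun m hm => ?_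
      simp [hm]; ring
    · intro m hm
      simp [(Finset.mem_filter.1 hm).2]
  rw [h1, Finset.sum_sub_distrib, h2, ← Finset.sum_sub_distrib, Finset.sum_eq_single (s := Finset.univ) i]
  · rw [hit_self hβ, utility]; ring
  · intro k _ hk
    rw [hit_eq_sum hβ x hk]; ring
  · simp

/-- The walk is stopped at `i`, so the out-links of `i` are never used. -/
theorem hit_update (hβ : β ∈ Set.Ioo (0 : ℝ) 1) (x : Config₂ V) (i : V)
    (a : Action (fun _ => 2) i) : hit β (Function.update x i a) i = hit β x i := by
  funext k
  exact hit_congr hβ Set.univ (fun k _ hk => by simp [hk]) (by simp) (Set.mem_univ k)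

theorem sum_hit_pair_le (hβ : β ∈ Set.Ioo (0 : ℝ) 1) (x : Config₂ V) (i : V)
    (a : Action (fun _ : V => 2) i) : ∑ m ∈ a.1, hit β x i m ≤ 2 := by
  calc _ ≤ ∑ m ∈ a.1, (1 : ℝ) := Finset.sum_le_sum fun m _ => hit_le_one hβ x i m
    _ = 2 := by simp [a.2.2]

/-- Best responses maximize the sum of the hitting probabilities of the chosen nodes. -/
theorem mem_bestResponses_iff (hβ : β ∈ Set.Ioo (0 : ℝ) 1) (hη : ∀ i, 0 < η i) (x : Config₂ V)
    (i : V) (a : Action (fun _ => 2) i) :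
    a ∈ Game.bestResponses (utility (fun _ => 2) β η) i x ↔
      ∀ b : Action (fun _ => 2) i, ∑ m ∈ b.1, hit β x i m ≤ ∑ m ∈ a.1, hit β x i m := by
  have h1 := hβ.1
  have h2 := hβ.2
  -- The numerator is positive and the same for all actions `b`; the denominator is positive and
  -- decreases with the sum over `b`.
  have hu : ∀ b : Action (fun _ => 2) i, utility (fun _ => 2) β η i (Function.update x i b) =
      ((1 - β) * ∑ k, hit β x i k * η k) / (1 - β / 2 * ∑ m ∈ b.1, hit β x i m) := by
    intro b
    have hb := sum_hit_pair_le hβ x i b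
    rw [eq_div_iff (by nlinarith)]
    have := utility_mul_eq (η := η) hβ (Function.update x i b) i
    rwa [hit_update hβ, Function.update_self] at this
  have hpos : 0 < (1 - β) * ∑ k, hit β x i k * η k := by
    apply mul_pos (by linarith)
    apply Finset.sum_pos'
    · intro k _
      exact mul_nonneg (hit_nonneg hβ x i k) (hη k).le
    · exact ⟨i, Finset.mem_univ i, by rw [hit_self hβ, one_mul]; exact hη i⟩
  simp only [Game.bestResponses, Set.mem_ofPred_eq, hu]
  refine forall_congr' fun b => ?_
  have hb := sum_hit_pair_le hβ x i b
  have ha := sum_hit_pair_le hβ x i a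
  rw [div_le_div_iff_of_pos_left hpos (by nlinarith) (by nlinarith)]
  constructor <;> intro h <;> nlinarith

/-- The objective is additive over the chosen nodes, so optimality only has to be tested against
swaps of a single node. -/
theorem mem_bestResponses_iff_exchange (hβ : β ∈ Set.Ioo (0 : ℝ) 1) (hη : ∀ i, 0 < η i)
    (x : Config₂ V) (i : V) (a : Action (fun _ => 2) i) :
    a ∈ Game.bestResponses (utility (fun _ => 2) β η) i x ↔
      ∀ p ∈ a.1, ∀ q, q ∉ a.1 → q ≠ i → hit β x i q ≤ hit β x i p := by
  rw [mem_bestResponses_iff hβ hη]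
  obtain ⟨a, hia, hca⟩ := a
  obtain ⟨p, q, hpq, rfl⟩ := Finset.card_eq_two.1 hca
  simp only [Finset.mem_insert, Finset.mem_singleton, not_or] at hia
  constructor
  · intro h k hk m hm hmi
    simp only [Finset.mem_insert, Finset.mem_singleton, not_or] at hk hm
    rcases hk with rfl | rfl
    · have := h ⟨{m, q}, by simp [hia.2, Ne.symm hmi], Finset.card_pair hm.2⟩
      simp only [Finset.sum_pair hm.2, Finset.sum_pair hpq] at this
      linarith
    · have := h ⟨{p, m}, by simp [hia.1, Ne.symm hmi], Finset.card_pair (Ne.symm hm.1)⟩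
      simp only [Finset.sum_pair (Ne.symm hm.1), Finset.sum_pair hpq] at this
      linarith
  · rintro h ⟨b, hib, hcb⟩
    obtain ⟨r, s, hrs, rfl⟩ := Finset.card_eq_two.1 hcb
    simp only [Finset.mem_insert, Finset.mem_singleton, not_or, forall_eq_or_imp, forall_eq]
      at h hib ⊢
    rw [Finset.sum_pair hrs, Finset.sum_pair hpq]
    obtain ⟨hp, hq⟩ := h
    by_cases hrp : r = p
    · subst hrp
      by_cases hsq : s = q
      · rw [hsq]
      · linarith [hq s ⟨Ne.symm hrs, hsq⟩ (Ne.symm hib.2)]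
    · by_cases hrq : r = q
      · subst hrq
        by_cases hsp : s = p
        · rw [hsp]; linarith
        · linarith [hp s ⟨hsp, Ne.symm hrs⟩ (Ne.symm hib.2)]
      · by_cases hsp : s = p
        · subst hsp
          linarith [hq r ⟨hrp, hrq⟩ (Ne.symm hib.1)]
        · by_cases hsq : s = q
          · subst hsq
            linarith [hp r ⟨hrp, hrq⟩ (Ne.symm hib.1)]
          · linarith [hp r ⟨hrp, hrq⟩ (Ne.symm hib.1), hq s ⟨hsp, hsq⟩ (Ne.symm hib.2)]

/-- A player whose targets strictly beat all other nodes has a unique best response. -/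
theorem bestResponses_eq_singleton (hβ : β ∈ Set.Ioo (0 : ℝ) 1) (hη : ∀ i, 0 < η i)
    {x : Config₂ V} {i : V} (h : ∀ p ∈ (x i).1, ∀ q, q ∉ (x i).1 → q ≠ i →
      hit β x i q < hit β x i p) :
    Game.bestResponses (utility (fun _ => 2) β η) i x = {x i} := by
  ext a
  rw [Set.mem_singleton_iff, mem_bestResponses_iff_exchange hβ hη]
  constructor
  · intro ha
    apply Subtype.ext
    symm
    apply Finset.eq_of_subset_of_card_le
    · intro p hp
      by_contra hpa
      have hne : ¬ a.1 ⊆ (x i).1 := by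
        intro hsub
        exact hpa (Finset.eq_of_subset_of_card_le hsub (by rw [a.2.2, card_links]) ▸ hp)
      obtain ⟨q, hqa, hqx⟩ := Finset.not_subset.1 hne
      have hqi : q ≠ i := by rintro rfl; exact a.2.1 hqa
      exact absurd (ha q hqa p hpa (ne_of_mem_links hp)) (not_le.2 (h p hp q hqx hqi))
    · rw [a.2.2, card_links]
  · rintro rfl p hp q hq hqi
    exact (h p hp q hq hqi).le

theorem pair_mem_bestResponses (hβ : β ∈ Set.Ioo (0 : ℝ) 1) (hη : ∀ i, 0 < η i)
    (x : Config₂ V) {i p q : V} (hpi : p ≠ i) (hqi : q ≠ i) (hpq : p ≠ q)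
    (h : ∀ k, k ≠ i → k ≠ p → k ≠ q → hit β x i k ≤ hit β x i p ∧ hit β x i k ≤ hit β x i q) :
    (⟨{p, q}, by simp [hpi.symm, hqi.symm], Finset.card_pair hpq⟩ : Action (fun _ => 2) i) ∈
      Game.bestResponses (utility (fun _ => 2) β η) i x := by
  rw [mem_bestResponses_iff_exchange hβ hη]
  intro m hm k hk hki
  simp only [Finset.mem_insert, Finset.mem_singleton, not_or] at hm hk
  rcases hm with rfl | rfl
  · exact (h k hki hk.1 hk.2).1
  · exact (h k hki hk.1 hk.2).2

/-- A move of player `i` to the links `p`, `q`. -/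
theorem exists_path_pair (hβ : β ∈ Set.Ioo (0 : ℝ) 1) (hη : ∀ i, 0 < η i)
    (x : Config₂ V) {i p q : V} (hpi : p ≠ i) (hqi : q ≠ i) (hpq : p ≠ q)
    (h : ∀ k, k ≠ i → k ≠ p → k ≠ q → hit β x i k ≤ hit β x i p ∧ hit β x i k ≤ hit β x i q) :
    ∃ y, Game.BestResponsePath (utility (fun _ => 2) β η) x y ∧ (y i).1 = {p, q} ∧
      ∀ k, k ≠ i → y k = x k := by
  have ha := pair_mem_bestResponses hβ hη x hpi hqi hpq h
  set a : Action (fun _ => 2) i := ⟨{p, q}, by simp [hpi.symm, hqi.symm], Finset.card_pair hpq⟩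
    with hadef
  refine ⟨Function.update x i a, ?_, by simp [hadef], fun k hk => by simp [hk]⟩
  -- If the player already uses these links, the path has length `0`, since a step must change the
  -- configuration.
  by_cases hx : Function.update x i a = x
  · rw [hx]; exact Relation.ReflTransGen.refl
  · exact Relation.ReflTransGen.single ⟨hx, i, by simpa using ha, fun k hk => by simp [hk]⟩

end CentralityGame

/-! ### Triangles, sources and shortcuts -/

namespace CentralityGame

variable {V : Type*} [DecidableEq V]

/-- Best response paths of the centrality game with two links per player. -/
abbrev BRPath [Fintype V] (β : ℝ) (η : V → ℝ) (x y : Config₂ V) : Prop :=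
  Game.BestResponsePath (utility (fun _ => 2) β η) x y

/-- All links of `x` are undirected. -/
def IsMutual (x : Config₂ V) : Prop := ∀ v, ∀ u ∈ (x v).1, v ∈ (x u).1

/-- The set `R` is a union of triangles of `x`. -/
def Triangles (x : Config₂ V) (R : Finset V) : Prop :=
  ∀ j ∈ R, ∃ a ∈ R, ∃ b ∈ R, a ≠ b ∧ (x j).1 = {a, b} ∧ (x a).1 = {j, b} ∧ (x b).1 = {j, a}

/-- The node `v` receives no link, or is part of a `2`-clique that receives no link. -/
def IsSource (x : Config₂ V) (v : V) : Prop :=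
  (∀ u, v ∉ (x u).1) ∨
    ∃ s, s ∈ (x v).1 ∧ v ∈ (x s).1 ∧ (∀ u, v ∈ (x u).1 → u = s) ∧ ∀ u, s ∈ (x u).1 → u = v

/-- The link from `v` to `u` completes a triangle with a node that is linked with both in both
directions, but has no reverse. -/
def IsShortcut (x : Config₂ V) (v u : V) : Prop :=
  ∃ p, (x v).1 = {p, u} ∧ (x p).1 = {v, u} ∧ p ∈ (x u).1 ∧ v ∉ (x u).1

theorem Triangles.closed {x : Config₂ V} {R : Finset V} (h : Triangles x R) {j k : V} (hj : j ∈ R)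
    (hk : k ∈ (x j).1) : k ∈ R ∧ j ∈ (x k).1 := by
  obtain ⟨a, ha, b, hb, -, hja, hxa, hxb⟩ := h j hj
  simp only [hja, Finset.mem_insert, Finset.mem_singleton] at hk
  rcases hk with rfl | rfl
  · exact ⟨ha, by simp [hxa]⟩
  · exact ⟨hb, by simp [hxb]⟩

theorem Triangles.congr {x y : Config₂ V} {R : Finset V} (h : Triangles x R)
    (hxy : ∀ v ∈ R, y v = x v) : Triangles y R := by
  intro j hj
  obtain ⟨a, ha, b, hb, hab, hja, hxa, hxb⟩ := h j hj
  exact ⟨a, ha, b, hb, hab, by rw [hxy j hj, hja], by rw [hxy a ha, hxa], by rw [hxy b hb, hxb]⟩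

theorem Triangles.union {x : Config₂ V} {R S : Finset V} (hR : Triangles x R)
    (hS : Triangles x S) : Triangles x (R ∪ S) := by
  intro j hj
  rcases Finset.mem_union.1 hj with h | h
  · obtain ⟨a, ha, b, hb, h⟩ := hR j h
    exact ⟨a, Finset.mem_union_left _ ha, b, Finset.mem_union_left _ hb, h⟩
  · obtain ⟨a, ha, b, hb, h⟩ := hS j h
    exact ⟨a, Finset.mem_union_right _ ha, b, Finset.mem_union_right _ hb, h⟩

theorem triangles_empty (x : Config₂ V) : Triangles x ∅ := by simp [Triangles]

theorem ne_of_links_eq {x : Config₂ V} {v p q : V} (h : (x v).1 = {p, q}) : p ≠ q := by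
  rintro rfl
  have := card_links x v
  simp [h] at this

theorem triangles_triple {x : Config₂ V} {a b c : V} (ha : (x a).1 = {b, c})
    (hb : (x b).1 = {a, c}) (hc : (x c).1 = {a, b}) : Triangles x {a, b, c} := by
  have h1 := ne_of_links_eq ha
  have h2 := ne_of_links_eq hb
  have h3 := ne_of_links_eq hc
  intro j hj
  simp only [Finset.mem_insert, Finset.mem_singleton] at hj
  rcases hj with rfl | rfl | rfl
  · exact ⟨b, by simp, c, by simp, h1, ha, hb, hc⟩
  · exact ⟨a, by simp, c, by simp, h2, hb, ha, by rw [hc, Finset.pair_comm]⟩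
  · exact ⟨a, by simp, b, by simp, h3, hc, by rw [ha, Finset.pair_comm],
      by rw [hb, Finset.pair_comm]⟩

variable [Fintype V] {β : ℝ} {η : V → ℝ}

/-! ### Elementary moves -/

section Moves

variable (hβ : β ∈ Set.Ioo (0 : ℝ) 1) (hη : ∀ i, 0 < η i) (x : Config₂ V)

include hβ hη

/-- A node without in-links is never hit from elsewhere, so all its actions are best responses. -/
theorem exists_path_of_forall_notMem {i p q : V} (hi : ∀ u, i ∉ (x u).1) (hpi : p ≠ i) (hqi : q ≠ i)
    (hpq : p ≠ q) :
    ∃ y, BRPath β η x y ∧ (y i).1 = {p, q} ∧ ∀ k, k ≠ i → y k = x k := by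
  refine exists_path_pair hβ hη x hpi hqi hpq fun k hk _ _ => ?_
  have : hit β x i k = 0 := hit_eq_zero_of_closed hβ {k | k ≠ i} (by simp)
    (fun k _ m hm h => hi k (h ▸ hm)) hk
  rw [this]
  exact ⟨hit_nonneg hβ x i p, hit_nonneg hβ x i q⟩

omit hη in
theorem hit_eq_zero_of_clique {r s k : V} (hr : ∀ u, r ∈ (x u).1 → u = s)
    (hs : ∀ u, s ∈ (x u).1 → u = r) (hkr : k ≠ r) (hks : k ≠ s) : hit β x r k = 0 := by
  refine hit_eq_zero_of_closed hβ {k | k ≠ r ∧ k ≠ s} (by simp) ?_ ⟨hkr, hks⟩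
  exact fun k hk m hm => ⟨fun h => hk.2 (hr k (h ▸ hm)), fun h => hk.1 (hs k (h ▸ hm))⟩

/-- Only `s` can have a positive value for `r`, so the second link of `r` is free. -/
theorem exists_path_of_clique {r s j : V} (hrs : r ≠ s) (hr : ∀ u, r ∈ (x u).1 → u = s)
    (hs : ∀ u, s ∈ (x u).1 → u = r) (hjr : j ≠ r) (hjs : j ≠ s) :
    ∃ y, BRPath β η x y ∧ (y r).1 = {s, j} ∧ ∀ k, k ≠ r → y k = x k := by
  refine exists_path_pair hβ hη x hrs.symm hjr hjs.symm fun k hkr hks _ => ?_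
  rw [hit_eq_zero_of_clique hβ x hr hs hkr hks]
  exact ⟨hit_nonneg hβ x r s, hit_nonneg hβ x r j⟩

/-- Both `p` and `q` attain the universal bound `β/(2-β)`. -/
theorem exists_path_of_triangle {i p q : V} (hp : (x p).1 = {i, q}) (hq : (x q).1 = {i, p}) :
    ∃ y, BRPath β η x y ∧ (y i).1 = {p, q} ∧ ∀ k, k ≠ i → y k = x k := by
  have hpi : p ≠ i := by rintro rfl; exact notMem_links x p (by simp [hp])
  have hqi : q ≠ i := by rintro rfl; exact notMem_links x q (by simp [hq])
  refine exists_path_pair hβ hη x hpi hqi (ne_of_links_eq hq |> fun h => ?_) fun k hk _ _ => ?_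
  · rintro rfl; exact notMem_links x p (by simp [hp])
  · rw [hit_eq_max hβ hp hq, hit_eq_max hβ hq hp]
    exact ⟨hit_le_max hβ x hk, hit_le_max hβ x hk⟩

/-- Two nodes that receive no links from elsewhere form a triangle with any other node. -/
theorem exists_path_triangle_of_clique {r s j : V} (hrs : r ≠ s)
    (hr : ∀ u, r ∈ (x u).1 → u = s) (hs : ∀ u, s ∈ (x u).1 → u = r) (hjr : j ≠ r) (hjs : j ≠ s) :
    ∃ y, BRPath β η x y ∧ Triangles y {r, s, j} ∧ ∀ k, k ∉ ({r, s, j} : Finset V) → y k = x k := by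
  -- The nodes `r`, `s` and `j` move in turn. The hypotheses also allow `r` and `s` not to be linked
  -- yet.
  obtain ⟨y, hxy, hyr, hy⟩ := exists_path_of_clique hβ hη x hrs hr hs hjr hjs
  have hr' : ∀ u, r ∈ (y u).1 → u = s := by
    intro u hu
    by_cases h : u = r
    · subst h; exact absurd hu (notMem_links y u)
    · rw [hy u h] at hu; exact hr u hu
  have hs' : ∀ u, s ∈ (y u).1 → u = r := by
    intro u hu
    by_contra h
    rw [hy u h] at hu; exact h (hs u hu)
  obtain ⟨z, hyz, hzs, hz⟩ := exists_path_of_clique hβ hη y hrs.symm hs' hr' hjs hjr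
  have hzr : (z r).1 = {s, j} := by rw [hz r hrs, hyr]
  obtain ⟨w, hzw, hwj, hw⟩ := exists_path_of_triangle hβ hη z (i := j) (p := r) (q := s)
    (by rw [hzr, Finset.pair_comm]) (by rw [hzs, Finset.pair_comm])
  refine ⟨w, (hxy.trans hyz).trans hzw, ?_, ?_⟩
  · exact triangles_triple (by rw [hw r hjr.symm, hzr]) (by rw [hw s hjs.symm, hzs]) hwj
  · intro k hk
    simp only [Finset.mem_insert, Finset.mem_singleton, not_or] at hk
    rw [hw k hk.2.2, hz k hk.2.1, hy k hk.1]

/-- Two nodes that receive no links become a clique, each keeping one of its links. -/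
theorem exists_path_clique {r s j k : V} (hrs : r ≠ s)
    (hr : ∀ u, r ∉ (x u).1) (hs : ∀ u, s ∉ (x u).1) (hjr : j ≠ r) (hjs : j ≠ s) (hkr : k ≠ r)
    (hks : k ≠ s) :
    ∃ y, BRPath β η x y ∧ (y r).1 = {s, j} ∧ (y s).1 = {r, k} ∧
      ∀ v, v ≠ r → v ≠ s → y v = x v := by
  obtain ⟨y, hxy, hyr, hy⟩ := exists_path_of_forall_notMem hβ hη x hr hrs.symm hjr hjs.symm
  have hr' : ∀ u, r ∈ (y u).1 → u = s := by
    intro u hu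
    by_cases h : u = r
    · subst h; exact absurd hu (notMem_links y u)
    · rw [hy u h] at hu; exact absurd hu (hr u)
  have hs' : ∀ u, s ∈ (y u).1 → u = r := by
    intro u hu
    by_contra h
    rw [hy u h] at hu; exact hs u hu
  obtain ⟨z, hyz, hzs, hz⟩ := exists_path_of_clique hβ hη y hrs.symm hs' hr' hks hkr
  exact ⟨z, hxy.trans hyz, by rw [hz r hrs, hyr], hzs, fun v hvr hvs => by rw [hz v hvs, hy v hvr]⟩

/-- The first two nodes of a path form a triangle with the third one. -/
theorem exists_path_triangle_of_path {a b c : V} (hab : a ≠ b) (hac : a ≠ c)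
    (ha : ∀ u, a ∈ (x u).1 → u = b)
    (hb : (x b).1 = {a, c}) (hb' : ∀ u, b ∈ (x u).1 → u = a ∨ u = c) :
    ∃ y, BRPath β η x y ∧ Triangles y {a, b, c} ∧ ∀ k, k ∉ ({a, b, c} : Finset V) → y k = x k := by
  have hbc : b ≠ c := by rintro rfl; exact notMem_links x b (by simp [hb])
  -- Only `b` links to `a`, so a walk from elsewhere passes through `b` before it hits `a`.
  have h1 : hit β x a c ≤ hit β x a b := by
    refine hit_le_of_closed hβ {k | k ≠ a ∧ k ≠ b} (hit_nonneg hβ x a b) (by simp) ?_ c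
      ⟨hac.symm, hbc.symm⟩
    intro k hk m hm
    by_cases hmb : m = b
    · right; rw [hmb]
    · left; exact ⟨fun h => hk.2 (ha k (h ▸ hm)), hmb⟩
  -- Only `a` and `c` link to `b`, so from other nodes the walk passes through `c` first.
  have h2 : ∀ k, k ≠ a → k ≠ b → k ≠ c → hit β x a k ≤ hit β x a c := by
    intro k hka hkb hkc
    refine hit_le_of_closed hβ {k | k ≠ a ∧ k ≠ b ∧ k ≠ c} (hit_nonneg hβ x a c) (by simp) ?_ k
      ⟨hka, hkb, hkc⟩
    intro k hk m hm
    by_cases hmc : m = c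
    · right; rw [hmc]
    · left
      exact ⟨fun h => hk.2.1 (ha k (h ▸ hm)), fun h => (hb' k (h ▸ hm)).elim hk.1 hk.2.2, hmc⟩
  obtain ⟨y, hxy, hya, hy⟩ := exists_path_pair hβ hη x hab.symm hac.symm hbc
    fun k hka hkb hkc => ⟨(h2 k hka hkb hkc).trans h1, h2 k hka hkb hkc⟩
  have hyb : (y b).1 = {a, c} := by rw [hy b hab.symm, hb]
  obtain ⟨z, hyz, hzc, hz⟩ := exists_path_of_triangle hβ hη y (i := c) (p := a) (q := b)
    (by rw [hya, Finset.pair_comm]) (by rw [hyb, Finset.pair_comm])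
  refine ⟨z, hxy.trans hyz, ?_, ?_⟩
  · exact triangles_triple (by rw [hz a hac, hya]) (by rw [hz b hbc, hyb]) hzc
  · intro k hk
    simp only [Finset.mem_insert, Finset.mem_singleton, not_or] at hk
    rw [hz k hk.2.2, hy k hk.1]

/-- A node that receives no link forms a triangle with any node `j` that receives further links and
with a node that links to `j`. -/
theorem exists_path_triangle_of_singleton {i j : V} (hij : j ≠ i) (hi : ∀ u, i ∉ (x u).1)
    (hj : ∃ u, u ≠ i ∧ j ∈ (x u).1) :
    ∃ y a, j ∈ (x a).1 ∧ BRPath β η x y ∧ Triangles y {i, j, a} ∧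
      ∀ k, k ∉ ({i, j, a} : Finset V) → y k = x k := by
  have h1 := hβ.1
  have h2 := hβ.2
  obtain ⟨u₀, hu₀i, hu₀⟩ := hj
  have hu₀j : u₀ ≠ j := (ne_of_mem_links hu₀).symm
  -- The best node for `j` apart from `i`. If it did not link to `j`, its positive value would be
  -- `β` times an average of values that are no larger.
  obtain ⟨a, ⟨haj, hai⟩, hmax⟩ := Set.exists_max_image {k | k ≠ j ∧ k ≠ i} (hit β x j)
    (Set.toFinite _) ⟨u₀, hu₀j, hu₀i⟩
  have hapos : 0 < hit β x j a := (hit_pos hβ hu₀).trans_le (hmax u₀ ⟨hu₀j, hu₀i⟩)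
  have hja : j ∈ (x a).1 := by
    by_contra hja
    obtain ⟨p, q, hpq, hxa⟩ := exists_links_eq x a
    have hp : hit β x j p ≤ hit β x j a :=
      hmax p ⟨by rintro rfl; simp [hxa] at hja, by rintro rfl; exact hi a (by simp [hxa])⟩
    have hq : hit β x j q ≤ hit β x j a :=
      hmax q ⟨by rintro rfl; simp [hxa] at hja, by rintro rfl; exact hi a (by simp [hxa])⟩
    have := hit_eq_pair hβ haj hxa
    nlinarith
  obtain ⟨y, hxy, hyi, hy⟩ := exists_path_of_forall_notMem hβ hη x hi hij hai haj.symm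
  have hcong : ∀ k, k ≠ i → hit β x j k = hit β y j k := fun k hk =>
    hit_congr hβ {k | k ≠ i} (fun k hk _ => (hy k hk).symm)
      (fun k _ _ m hm h => hi k (h ▸ hm)) hk
  -- After the move, `i` links to `j` and to the best node `a`, whereas `a` links to `j` and to some
  -- `q` that is no better than `a`.
  have hya : hit β y j a ≤ hit β y j i := by
    rw [hit_eq_pair hβ hij.symm hyi, hit_self hβ, ← hcong a hai]
    obtain ⟨q, hqj, hxa⟩ := exists_other hja
    have e := hit_eq_pair hβ haj hxa
    rw [hit_self hβ] at e
    have := hmax q ⟨hqj, by rintro rfl; exact hi a (by simp [hxa])⟩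
    nlinarith
  obtain ⟨z, hyz, hzj, hz⟩ := exists_path_pair hβ hη y hij.symm haj hai.symm (by
    intro k hkj hki hka
    have : hit β y j k ≤ hit β y j a := by
      rw [← hcong k hki, ← hcong a hai]; exact hmax k ⟨hkj, hki⟩
    exact ⟨this.trans hya, this⟩)
  have hzi : (z i).1 = {j, a} := by rw [hz i hij.symm, hyi]
  obtain ⟨w, hzw, hwa, hw⟩ := exists_path_of_triangle hβ hη z (i := a) (p := i) (q := j)
    (by rw [hzi, Finset.pair_comm]) (by rw [hzj, Finset.pair_comm])
  refine ⟨w, a, hja, (hxy.trans hyz).trans hzw, ?_, ?_⟩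
  · exact triangles_triple (by rw [hw i hai.symm, hzi]) (by rw [hw j haj.symm, hzj]) hwa
  · intro k hk
    simp only [Finset.mem_insert, Finset.mem_singleton, not_or] at hk
    rw [hw k hk.2.2, hz k hk.2.1, hy k hk.1]

/-- A single node that receives no link and the triangles formed by all other nodes can turn into
undirected rings. -/
theorem exists_path_isMutual_of_singleton {i : V} (hi : ∀ u, i ∉ (x u).1)
    (hT : Triangles x ({i}ᶜ)) : ∃ y, BRPath β η x y ∧ IsMutual y := by
  obtain ⟨j, q, _, hxi⟩ := exists_links_eq x i
  have hji : j ≠ i := ne_of_mem_links (x := x) (by simp [hxi])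
  obtain ⟨a, ha, b, hb, hab, hxj, hxa, hxb⟩ := hT j (by simpa using hji)
  have hai : a ≠ i := by simpa using ha
  have hbi : b ≠ i := by simpa using hb
  have hja : j ≠ a := (ne_of_mem_links (x := x) (by simp [hxj])).symm
  have hjb : j ≠ b := (ne_of_mem_links (x := x) (by simp [hxj])).symm
  have hclosed : ∀ k, k ≠ i → ∀ m ∈ (x k).1, m ≠ i ∧ k ∈ (x m).1 := by
    intro k hk m hm
    simpa using hT.closed (by simpa using hk) hm
  -- Here `i` copies the links of `b` in the triangle `j a b`. Then `j` may trade `a` for `i`, and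
  -- `a` answers with `i` and `b`: the result is the ring `i j b a`.
  obtain ⟨y, hxy, hyi, hy⟩ := exists_path_of_forall_notMem hβ hη x hi hji hai hja
  have hya : (y a).1 = {j, b} := by rw [hy a hai, hxa]
  have hyb : (y b).1 = {j, a} := by rw [hy b hbi, hxb]
  have hM := hit_eq_max hβ hya hyb
  have hMb := hit_eq_max hβ hyb hya
  have hMi : hit β y j i = β / (2 - β) := by
    have e1 := hit_eq_pair hβ hji.symm hyi
    have e2 := hit_eq_pair hβ hja.symm hya
    rw [hM] at e1 e2
    rw [hMb] at e2
    exact e1.trans e2.symm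
  obtain ⟨z, hyz, hzj, hz⟩ := exists_path_pair hβ hη y hji.symm hjb.symm hbi.symm (by
    intro k hk _ _
    rw [hMi, hMb]
    exact ⟨hit_le_max hβ y hk, hit_le_max hβ y hk⟩)
  have hzi : (z i).1 = {j, a} := by rw [hz i hji.symm, hyi]
  have hzb : (z b).1 = {j, a} := by rw [hz b hjb.symm, hyb]
  have hza : (z a).1 = {j, b} := by rw [hz a hja.symm, hya]
  have hzo : ∀ k, k ≠ i → k ≠ j → z k = x k := fun k h1 h2 => by rw [hz k h2, hy k h1]
  have hib : hit β z a i = hit β z a b := by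
    rw [hit_eq_pair hβ hai.symm hzi, hit_eq_pair hβ hab.symm hzb]
  -- Now that `j` has dropped `a`, only `i` and `b` link to `a`, and they have equal values.
  have hle : ∀ k, k ≠ a → k ≠ i → k ≠ b → hit β z a k ≤ hit β z a b := by
    intro k hka hki hkb
    refine hit_le_of_closed hβ {k | k ≠ a ∧ k ≠ i ∧ k ≠ b} (hit_nonneg hβ z a b) (by simp) ?_ k
      ⟨hka, hki, hkb⟩
    intro k hk m hm
    by_cases hmi : m = i
    · right; rw [hmi, hib]
    by_cases hmb : m = b
    · right; rw [hmb]
    left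
    refine ⟨?_, hmi, hmb⟩
    rintro rfl
    by_cases hkj : k = j
    · subst hkj
      simp [hzj, hai, hab] at hm
    · rw [hzo k hk.2.1 hkj] at hm
      have := (hclosed k hk.2.1 _ hm).2
      simp [hxa, hkj, hk.2.2] at this
  obtain ⟨w, hzw, hwa, hw⟩ := exists_path_pair hβ hη z hai.symm hab.symm hbi.symm
    (fun k hka hki hkb => ⟨hib ▸ hle k hka hki hkb, hle k hka hki hkb⟩)
  refine ⟨w, (hxy.trans hyz).trans hzw, ?_⟩
  have hwi : (w i).1 = {j, a} := by rw [hw i hai.symm, hzi]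
  have hwj : (w j).1 = {i, b} := by rw [hw j hja, hzj]
  have hwb : (w b).1 = {j, a} := by rw [hw b hab.symm, hzb]
  intro v u hu
  by_cases hvi : v = i
  · subst hvi
    simp only [hwi, Finset.mem_insert, Finset.mem_singleton] at hu
    rcases hu with rfl | rfl <;> simp [*]
  by_cases hvj : v = j
  · subst hvj
    simp only [hwj, Finset.mem_insert, Finset.mem_singleton] at hu
    rcases hu with rfl | rfl <;> simp [*]
  by_cases hva : v = a
  · subst hva
    simp only [hwa, Finset.mem_insert, Finset.mem_singleton] at hu
    rcases hu with rfl | rfl <;> simp [*]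
  by_cases hvb : v = b
  · subst hvb
    simp only [hwb, Finset.mem_insert, Finset.mem_singleton] at hu
    rcases hu with rfl | rfl <;> simp [*]
  rw [hw v hva, hzo v hvi hvj] at hu
  have hv := hclosed v hvi u hu
  have huj : u ≠ j := by rintro rfl; simp [hxj, hva, hvb] at hv
  have hua : u ≠ a := by rintro rfl; simp [hxa, hvj, hvb] at hv
  rw [hw u hua, hzo u hv.1 huj]
  exact hv.2

end Moves

end CentralityGame

/-! ### Absorbing nodes into a growing set of triangles -/

namespace CentralityGame

variable {V : Type*} [DecidableEq V]

/-- All nodes but the two of a clique, each with one further link, form triangles. -/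
def IsTrianglesWithClique [Fintype V] (x : Config₂ V) : Prop :=
  ∃ r s, r ≠ s ∧ s ∈ (x r).1 ∧ r ∈ (x s).1 ∧ Triangles x ({r, s}ᶜ)

/-- `R` is a union of triangles, and links to nodes outside of `R` are undirected. -/
def IsCore (x : Config₂ V) (R : Finset V) : Prop :=
  Triangles x R ∧ ∀ v, ∀ u ∈ (x v).1, u ∉ R → v ∈ (x u).1

/-- `R` is a union of triangles, and links to nodes outside of `R` are undirected or start at
sources. -/
def IsSourceCore (x : Config₂ V) (R : Finset V) : Prop :=
  Triangles x R ∧ ∀ v, ∀ u ∈ (x v).1, u ∉ R → v ∈ (x u).1 ∨ IsSource x v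

/-- `R` is a union of triangles, and links to nodes outside of `R` are undirected, start at
sources, or are shortcuts. -/
def IsShortcutCore (x : Config₂ V) (R : Finset V) : Prop :=
  Triangles x R ∧ ∀ v, ∀ u ∈ (x v).1, u ∉ R → v ∈ (x u).1 ∨ IsSource x v ∨ IsShortcut x v u

section Extend

variable {x y : Config₂ V} {R T : Finset V}

theorem Triangles.extend (hR : Triangles x R) (hT : Triangles y T) (hd : Disjoint R T)
    (hy : ∀ k, k ∉ T → y k = x k) : Triangles y (R ∪ T) :=
  (hR.congr fun v hv => hy v (Finset.disjoint_left.1 hd hv)).union hT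

/-- Triangles have no outgoing links, so a link to a node outside of `R ∪ T` also starts outside and
is unchanged. -/
theorem IsCore.extend (h : IsCore x R) (hT : Triangles y T) (hd : Disjoint R T)
    (hy : ∀ k, k ∉ T → y k = x k) : IsCore y (R ∪ T) := by
  have hRT := h.1.extend hT hd hy
  refine ⟨hRT, fun v u hu huR => ?_⟩
  have hvR : v ∉ R ∪ T := fun hv => huR (hRT.closed hv hu).1
  simp only [Finset.mem_union, not_or] at huR hvR
  rw [hy v hvR.2] at hu
  rw [hy u huR.2]
  exact h.2 v u hu huR.1

/-- Nodes outside of `R ∪ T` can only lose in-links. If the clique partner of `v` lies in `R ∪ T`,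
then `v` is left without in-links. -/
theorem IsSource.extend (hRT : Triangles y (R ∪ T)) (hy : ∀ k, k ∉ T → y k = x k) {v : V}
    (hv : v ∉ R ∪ T) (h : IsSource x v) : IsSource y v := by
  have hin : ∀ w, ∀ v, v ∉ R ∪ T → v ∈ (y w).1 → v ∈ (x w).1 := by
    intro w v hv hw
    have hwT : w ∉ T := fun hwT => hv (hRT.closed (Finset.mem_union_right _ hwT) hw).1
    rwa [hy w hwT] at hw
  rcases h with h | ⟨s, hvs, hsv, hv', hs'⟩
  · exact Or.inl fun u hu => h u (hin u v hv hu)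
  by_cases hs : s ∈ R ∪ T
  · left
    intro u hu
    have := hv' u (hin u v hv hu)
    subst this
    exact hv (hRT.closed hs hu).1
  · right
    have hvT : v ∉ T := fun h => hv (Finset.mem_union_right _ h)
    have hsT : s ∉ T := fun h => hs (Finset.mem_union_right _ h)
    exact ⟨s, by rwa [hy v hvT], by rwa [hy s hsT], fun u hu => hv' u (hin u v hv hu),
      fun u hu => hs' u (hin u s hs hu)⟩

theorem IsSourceCore.extend (h : IsSourceCore x R) (hT : Triangles y T) (hd : Disjoint R T)
    (hy : ∀ k, k ∉ T → y k = x k) : IsSourceCore y (R ∪ T) := by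
  have hRT := h.1.extend hT hd hy
  refine ⟨hRT, fun v u hu huR => ?_⟩
  have hvR : v ∉ R ∪ T := fun hv => huR (hRT.closed hv hu).1
  have huT : u ∉ T := fun h => huR (Finset.mem_union_right _ h)
  have hvT : v ∉ T := fun h => hvR (Finset.mem_union_right _ h)
  rw [hy v hvT] at hu
  rw [hy u huT]
  exact (h.2 v u hu fun h => huR (Finset.mem_union_left _ h)).imp id
    (fun h => h.extend hRT hy hvR)

theorem card_compl_union_lt [Fintype V] (hd : Disjoint R T) (hT : T.Nonempty) :
    (R ∪ T)ᶜ.card < Rᶜ.card := by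
  obtain ⟨a, ha⟩ := hT
  apply Finset.card_lt_card
  rw [Finset.ssubset_iff_of_subset (by
    intro k hk; simp only [Finset.mem_compl, Finset.mem_union, not_or] at hk ⊢; exact hk.1)]
  exact ⟨a, by simpa using Finset.disjoint_right.1 hd ha, by simp [ha]⟩

theorem disjoint_triple {a b c : V} (ha : a ∉ R) (hb : b ∉ R) (hc : c ∉ R) :
    Disjoint R {a, b, c} := by
  rw [Finset.disjoint_right]
  intro k hk
  simp only [Finset.mem_insert, Finset.mem_singleton] at hk
  rcases hk with rfl | rfl | rfl <;> assumption

end Extend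

variable [Fintype V] {β : ℝ} {η : V → ℝ}

theorem eq_compl_pair {R : Finset V} {i s : V} (hi : i ∉ R) (hs : s ∉ R)
    (h : ∀ j, j ∉ R → j = i ∨ j = s) : R = {i, s}ᶜ := by
  ext k
  simp only [Finset.mem_compl, Finset.mem_insert, Finset.mem_singleton]
  constructor
  · rintro hk (rfl | rfl) <;> contradiction
  · intro hk; by_contra hkR; exact hk (h k hkR)

/-- Induction on the number of nodes outside of `R`. An outside node with at most one in-neighbour
can be put into a new triangle, unless only one or two nodes are left outside; these end in a ring
of length `4` or in a source clique. If all outside nodes have two in-neighbours, all links are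
undirected. -/
theorem exists_path_of_isCore (hβ : β ∈ Set.Ioo (0 : ℝ) 1) (hη : ∀ i, 0 < η i) (n : ℕ) :
    ∀ (x : Config₂ V) (R : Finset V), Rᶜ.card = n → IsCore x R →
      ∃ y, BRPath β η x y ∧ (IsMutual y ∨ IsTrianglesWithClique y) := by
  induction n using Nat.strong_induction_on with
  | _ n ih =>
  intro x R hn hR
  subst hn
  have step : ∀ (y : Config₂ V) (a b c : V), BRPath β η x y → Triangles y {a, b, c} →
      (∀ k, k ∉ ({a, b, c} : Finset V) → y k = x k) → a ∉ R → b ∉ R → c ∉ R →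
      ∃ y, BRPath β η x y ∧ (IsMutual y ∨ IsTrianglesWithClique y) := by
    intro y a b c hxy hT hy ha hb hc
    have hd := disjoint_triple ha hb hc
    obtain ⟨z, hyz, hz⟩ := ih _ (card_compl_union_lt hd (by simp)) y _ rfl (hR.extend hT hd hy)
    exact ⟨z, hxy.trans hyz, hz⟩
  by_cases hsing : ∃ i, ∀ u, i ∉ (x u).1
  · obtain ⟨i, hi⟩ := hsing
    have hiR : i ∉ R := by
      intro h
      obtain ⟨a, -, b, -, -, -, hxa, -⟩ := hR.1 i h
      exact hi a (by simp [hxa])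
    by_cases h1 : ∃ j, j ∉ R ∧ j ≠ i ∧ ∃ u, j ∈ (x u).1
    · obtain ⟨j, hjR, hji, u, hu⟩ := h1
      have hju : u ∈ (x j).1 := hR.2 u j hu hjR
      obtain ⟨y, a, ha, hxy, hT, hy⟩ := exists_path_triangle_of_singleton hβ hη x hji hi
        ⟨u, by rintro rfl; exact hi j hju, hu⟩
      exact step y i j a hxy hT hy hiR hjR fun haR => hjR (hR.1.closed haR ha).1
    · push Not at h1
      by_cases h2 : ∃ s, s ∉ R ∧ s ≠ i
      · obtain ⟨s, hsR, hsi⟩ := h2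
        have hs := h1 s hsR hsi
        by_cases h3 : ∃ j, j ∉ R ∧ j ≠ i ∧ j ≠ s
        · obtain ⟨j, hjR, hji, hjs⟩ := h3
          obtain ⟨y, hxy, hT, hy⟩ := exists_path_triangle_of_clique hβ hη x hsi.symm
            (fun u hu => absurd hu (hi u)) (fun u hu => absurd hu (hs u)) hji hjs
          exact step y i s j hxy hT hy hiR hsR hjR
        · push Not at h3
          have hRe : R = {i, s}ᶜ := eq_compl_pair hiR hsR fun j hj => by
            by_cases h : j = i
            · exact Or.inl h
            · exact Or.inr (h3 j hj h)
          obtain ⟨j, _, _, hxi⟩ := exists_links_eq x i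
          obtain ⟨k, _, _, hxs⟩ := exists_links_eq x s
          obtain ⟨y, hxy, hyi, hys, hy⟩ := exists_path_clique hβ hη x (j := j) (k := k) hsi.symm hi hs
            (by rintro rfl; exact hi _ (by rw [hxi]; simp))
            (by rintro rfl; exact hs i (by rw [hxi]; simp))
            (by rintro rfl; exact hi s (by rw [hxs]; simp))
            (by rintro rfl; exact hs _ (by rw [hxs]; simp))
          refine ⟨y, hxy, Or.inr ⟨i, s, hsi.symm, by simp [hyi], by simp [hys], ?_⟩⟩
          rw [← hRe]
          exact hR.1.congr fun v hv => hy v (by rintro rfl; exact hiR hv)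
            (by rintro rfl; exact hsR hv)
      · push Not at h2
        have hRe : R = {i}ᶜ := by
          ext k
          simp only [Finset.mem_compl, Finset.mem_singleton]
          exact ⟨by rintro hk rfl; exact hiR hk, fun hk => by_contra fun hkR => hk (h2 k hkR)⟩
        obtain ⟨y, hxy, hy⟩ := exists_path_isMutual_of_singleton hβ hη x hi (hRe ▸ hR.1)
        exact ⟨y, hxy, Or.inl hy⟩
  · push Not at hsing
    by_cases h1 : ∃ v w, v ∉ R ∧ ∀ u, v ∈ (x u).1 → u = w
    · obtain ⟨v, w, hv, hvw⟩ := h1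
      have hwv : v ∈ (x w).1 := by
        obtain ⟨u, hu⟩ := hsing v
        rwa [hvw u hu] at hu
      have hw : w ∉ R := fun h => hv (hR.1.closed h hwv).1
      have hvne : v ≠ w := ne_of_mem_links hwv
      have hxv : w ∈ (x v).1 := hR.2 w v hwv hv
      obtain ⟨c, hcv, hxw⟩ := exists_other hwv
      -- Either `v`, `w`, `c` are the beginning of an undirected path, or `v` and `w` form a source
      -- clique.
      by_cases h2 : w ∈ (x c).1
      · have hcR : c ∉ R := fun h => hw (hR.1.closed h h2).1
        obtain ⟨y, hxy, hT, hy⟩ := exists_path_triangle_of_path hβ hη x hvne hcv.symm hvw hxw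
          (fun u hu => by have := hR.2 u w hu hw; rw [hxw] at this; simpa using this)
        exact step y v w c hxy hT hy hv hw hcR
      · have hw' : ∀ u, w ∈ (x u).1 → u = v := by
          intro u hu
          have := hR.2 u w hu hw
          simp only [hxw, Finset.mem_insert, Finset.mem_singleton] at this
          rcases this with rfl | rfl
          · rfl
          · contradiction
        by_cases h3 : ∃ j, j ∉ R ∧ j ≠ v ∧ j ≠ w
        · obtain ⟨j, hjR, hjv, hjw⟩ := h3
          obtain ⟨y, hxy, hT, hy⟩ := exists_path_triangle_of_clique hβ hη x hvne hvw hw' hjv hjw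
          exact step y v w j hxy hT hy hv hw hjR
        · push Not at h3
          refine ⟨x, Relation.ReflTransGen.refl, Or.inr ⟨v, w, hvne, hxv, hwv, ?_⟩⟩
          rw [← eq_compl_pair hv hw fun j hj => ?_]
          · exact hR.1
          · by_cases h : j = v
            · exact Or.inl h
            · exact Or.inr (h3 j hj h)
    · refine ⟨x, Relation.ReflTransGen.refl, Or.inl fun v u hu => ?_⟩
      by_cases huR : u ∈ R
      · by_cases hvR : v ∈ R
        · exact (hR.1.closed hvR hu).2
        -- A link from outside into `R` uses one of the two links of `v`. In-links of `v` are
        -- undirected and do not come from `R`, so only the other target `w` can link to `v`,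
        -- against `h1`.
        · exfalso
          apply h1
          obtain ⟨w, -, hxv⟩ := exists_other hu
          refine ⟨v, w, hvR, fun k hk => ?_⟩
          have := hR.2 k v hk hvR
          simp only [hxv, Finset.mem_insert, Finset.mem_singleton] at this
          rcases this with rfl | rfl
          · exact absurd (hR.1.closed huR hk).1 hvR
          · rfl
      · exact hR.2 v u hu huR

end CentralityGame

/-! ### From Nash equilibria to undirected rings or triangles with a clique -/

namespace CentralityGame

variable {V : Type*} [DecidableEq V] [Fintype V] {β : ℝ} {η : V → ℝ}

/-- A source can drop its links to nodes of other components in favor of links to `R`. -/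
theorem exists_path_retarget (hβ : β ∈ Set.Ioo (0 : ℝ) 1) (hη : ∀ i, 0 < η i)
    {x : Config₂ V} {R : Finset V} (hR : IsSourceCore x R) (hne : R.Nonempty) {v u : V}
    (hu : u ∈ (x v).1) (huR : u ∉ R) (hvu : v ∉ (x u).1) :
    ∃ y, BRPath β η x y ∧ (∀ k, k ≠ v → y k = x k) ∧
      (∀ k ∈ (y v).1, k ∉ R → k ∈ (x v).1 ∧ v ∈ (x k).1) ∧
      (∀ k ∈ (x v).1, v ∈ (x k).1 → k ∈ (y v).1) := by
  have hvR : v ∉ R := fun hv => huR (hR.1.closed hv hu).1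
  -- Two nodes of `R` as new targets; a clique node keeps the link to its partner and needs only
  -- one.
  obtain ⟨g, hg⟩ := hne
  obtain ⟨g', hg', _, -, -, hxg, -⟩ := hR.1 g hg
  have hgg' : g' ≠ g := ne_of_mem_links (x := x) (by simp [hxg])
  have hgv : g ≠ v := by rintro rfl; contradiction
  have hgv' : g' ≠ v := by rintro rfl; contradiction
  rcases (hR.2 v u hu huR).resolve_left hvu with h | ⟨s, hvs, hsv, hv', hs'⟩
  · obtain ⟨y, hxy, hyv, hy⟩ := exists_path_of_forall_notMem hβ hη x h hgv hgv' hgg'.symm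
    refine ⟨y, hxy, hy, ?_, fun k _ hk => absurd hk (h k)⟩
    intro k hk hkR
    simp only [hyv, Finset.mem_insert, Finset.mem_singleton] at hk
    rcases hk with rfl | rfl <;> contradiction
  · have hsR : s ∉ R := fun h => hvR (hR.1.closed h hsv).1
    have hgs : g ≠ s := by rintro rfl; contradiction
    obtain ⟨y, hxy, hyv, hy⟩ := exists_path_of_clique hβ hη x (ne_of_mem_links hsv) hv' hs' hgv hgs
    refine ⟨y, hxy, hy, ?_, fun k _ hk => by rw [hv' k hk, hyv]; simp⟩
    intro k hk hkR
    simp only [hyv, Finset.mem_insert, Finset.mem_singleton] at hk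
    rcases hk with rfl | rfl
    · exact ⟨hvs, hsv⟩
    · contradiction

/-- Induction on the number of nodes with a link out of `R` that has no reverse. Redirecting one
such source repairs it and harms no other node: it keeps its undirected links and creates in-links
only inside `R`. -/
theorem exists_path_isCore_of_isSourceCore (hβ : β ∈ Set.Ioo (0 : ℝ) 1) (hη : ∀ i, 0 < η i)
    {R : Finset V} (hne : R.Nonempty) (n : ℕ) :
    ∀ (x : Config₂ V), (Finset.univ.filter fun v => ∃ u ∈ (x v).1, u ∉ R ∧ v ∉ (x u).1).card = n →
      IsSourceCore x R → ∃ y, BRPath β η x y ∧ IsCore y R := by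
  induction n using Nat.strong_induction_on with
  | _ n ih =>
  intro x hn hR
  subst hn
  by_cases hbad : ∃ v, ∃ u ∈ (x v).1, u ∉ R ∧ v ∉ (x u).1
  · obtain ⟨v, u, hu, huR, hvu⟩ := hbad
    have hvR : v ∉ R := fun hv => huR (hR.1.closed hv hu).1
    obtain ⟨y, hxy, hy, hyv, hyv'⟩ := exists_path_retarget hβ hη hR hne hu huR hvu
    have hT : Triangles y R := hR.1.congr fun k hk => hy k (by rintro rfl; contradiction)
    have hin : ∀ w, ∀ k, k ∉ R → k ∈ (y w).1 → k ∈ (x w).1 := by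
      intro w k hk hkw
      by_cases hwv : w = v
      · subst hwv; exact (hyv k hkw hk).1
      · rwa [hy w hwv] at hkw
    have hgood : ∀ w, w ≠ v → ∀ k ∈ (y w).1, k ∉ R → w ∈ (x k).1 → w ∈ (y k).1 := by
      intro w hwv k hk _ hwk
      rw [hy w hwv] at hk
      by_cases hkv : k = v
      · subst hkv; exact hyv' w hwk hk
      · rwa [hy k hkv]
    have hgoodv : ∀ k ∈ (y v).1, k ∉ R → v ∈ (y k).1 := by
      intro k hk hkR
      rw [hy k (ne_of_mem_links hk)]
      exact (hyv k hk hkR).2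
    have hsub : (Finset.univ.filter fun v => ∃ u ∈ (y v).1, u ∉ R ∧ v ∉ (y u).1).card <
        (Finset.univ.filter fun v => ∃ u ∈ (x v).1, u ∉ R ∧ v ∉ (x u).1).card := by
      apply Finset.card_lt_card
      rw [Finset.ssubset_iff_of_subset]
      · refine ⟨v, by simpa using ⟨u, hu, huR, hvu⟩, ?_⟩
        simp only [Finset.mem_filter, Finset.mem_univ, true_and, not_exists, not_and, not_not]
        exact hgoodv
      · intro w
        simp only [Finset.mem_filter, Finset.mem_univ, true_and]
        rintro ⟨k, hk, hkR, hwk⟩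
        have hwv : w ≠ v := by rintro rfl; exact hwk (hgoodv k hk hkR)
        exact ⟨k, by rwa [hy w hwv] at hk, hkR, fun h => hwk (hgood w hwv k hk hkR h)⟩
    have hyR : IsSourceCore y R := by
      refine ⟨hT, fun w k hk hkR => ?_⟩
      by_cases hwv : w = v
      · subst hwv; exact Or.inl (hgoodv k hk hkR)
      have hwR : w ∉ R := fun hw => hkR (hT.closed hw hk).1
      have hk' : k ∈ (x w).1 := by rwa [hy w hwv] at hk
      rcases hR.2 w k hk' hkR with h | h | ⟨s, hws, hsw, hw', hs'⟩
      · exact Or.inl (hgood w hwv k hk hkR h)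
      · exact Or.inr (Or.inl fun t ht => h t (hin t w hwR ht))
      · have hsR : s ∉ R := fun h => hwR (hR.1.closed h hsw).1
        refine Or.inr (Or.inr ⟨s, by rwa [hy w hwv], ?_, fun t ht => hw' t (hin t w hwR ht),
          fun t ht => hs' t (hin t s hsR ht)⟩)
        by_cases hsv : s = v
        · subst hsv; exact hyv' w hsw hws
        · rwa [hy s hsv]
    obtain ⟨z, hyz, hz⟩ := ih _ hsub y rfl hyR
    exact ⟨z, hxy.trans hyz, hz⟩
  · push Not at hbad
    exact ⟨x, Relation.ReflTransGen.refl, hR.1, hbad⟩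

/-- Redirecting links needs a nonempty `R`. Any source can be made part of a first triangle; without
sources, all links are undirected. -/
theorem exists_path_isSourceCore_nonempty (hβ : β ∈ Set.Ioo (0 : ℝ) 1) (hη : ∀ i, 0 < η i)
    {x : Config₂ V} (hx : IsSourceCore x ∅) :
    ∃ y, BRPath β η x y ∧ (IsMutual y ∨ ∃ R, R.Nonempty ∧ IsSourceCore y R) := by
  have hmut : ∀ v, ¬ IsSource x v → ∀ u ∈ (x v).1, v ∈ (x u).1 := fun v hv u hu =>
    (hx.2 v u hu (by simp)).resolve_right hv
  have step : ∀ (y : Config₂ V) (a b c : V), BRPath β η x y → Triangles y {a, b, c} →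
      (∀ k, k ∉ ({a, b, c} : Finset V) → y k = x k) →
      ∃ y, BRPath β η x y ∧ (IsMutual y ∨ ∃ R, R.Nonempty ∧ IsSourceCore y R) :=
    fun y a b c hxy hT hy => ⟨y, hxy, Or.inr ⟨_, by simp, hx.extend hT (by simp) hy⟩⟩
  by_cases hs : ∃ v, IsSource x v
  · obtain ⟨v, hv | ⟨s, hvs, hsv, hv', hs'⟩⟩ := hs
    · by_cases hw : ∃ w, w ≠ v ∧ IsSource x w
      · obtain ⟨w, hwv, hw | ⟨s, hws, hsw, hw', hs'⟩⟩ := hw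
        · obtain ⟨p, q, hpq, hxv⟩ := exists_links_eq x v
          obtain ⟨j, hj, hjw⟩ : ∃ j ∈ (x v).1, j ≠ w := by
            rw [hxv]
            by_cases h : p = w
            · exact ⟨q, by simp, fun h' => hpq (h.trans h'.symm)⟩
            · exact ⟨p, by simp, h⟩
          obtain ⟨y, hxy, hT, hy⟩ := exists_path_triangle_of_clique hβ hη x hwv.symm
            (fun u hu => absurd hu (hv u)) (fun u hu => absurd hu (hw u)) (ne_of_mem_links hj) hjw
          exact step y _ _ _ hxy hT hy
        · obtain ⟨c, hcs, hxw⟩ := exists_other hws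
          obtain ⟨y, hxy, hT, hy⟩ := exists_path_triangle_of_clique hβ hη x (ne_of_mem_links hsw)
            hw' hs' (ne_of_mem_links (x := x) (by simp [hxw])) hcs
          exact step y _ _ _ hxy hT hy
      · push Not at hw
        obtain ⟨j, q, _, hxv⟩ := exists_links_eq x v
        have hjv : j ≠ v := ne_of_mem_links (x := x) (by simp [hxv])
        obtain ⟨k, _, _, hxj⟩ := exists_links_eq x j
        have hjk : j ∈ (x k).1 := hmut j (hw j hjv) k (by simp [hxj])
        obtain ⟨y, a, -, hxy, hT, hy⟩ := exists_path_triangle_of_singleton hβ hη x hjv hv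
          ⟨k, by rintro rfl; exact hv j (by simp [hxj]), hjk⟩
        exact step y _ _ _ hxy hT hy
    · obtain ⟨c, hcs, hxv⟩ := exists_other hvs
      obtain ⟨y, hxy, hT, hy⟩ := exists_path_triangle_of_clique hβ hη x (ne_of_mem_links hsv)
        hv' hs' (ne_of_mem_links (x := x) (by simp [hxv])) hcs
      exact step y _ _ _ hxy hT hy
  · push Not at hs
    exact ⟨x, Relation.ReflTransGen.refl, Or.inl fun v => hmut v (hs v)⟩

/-- For the target `u` of a shortcut from `v` through `p`, both `v` and `p` attain the largest
possible value. So `u` may link to them, which closes a triangle that joins `R`. -/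
theorem exists_path_isSourceCore_of_isShortcutCore (hβ : β ∈ Set.Ioo (0 : ℝ) 1)
    (hη : ∀ i, 0 < η i) (n : ℕ) :
    ∀ (x : Config₂ V) (R : Finset V), Rᶜ.card = n → IsShortcutCore x R →
      ∃ y S, BRPath β η x y ∧ IsSourceCore y S := by
  induction n using Nat.strong_induction_on with
  | _ n ih =>
  intro x R hn hR
  subst hn
  by_cases hs : ∃ v u, u ∉ R ∧ IsShortcut x v u
  · obtain ⟨v, u, hu, p, hxv, hxp, hpu, hvu⟩ := hs
    have hvR : v ∉ R := fun h => hu (hR.1.closed h (by simp [hxv])).1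
    have hpR : p ∉ R := fun h => hu (hR.1.closed h (by simp [hxp])).1
    have hvne : v ≠ u := (ne_of_mem_links (x := x) (by simp [hxv])).symm
    have hpne : p ≠ u := ne_of_links_eq hxv
    obtain ⟨y, hxy, hyu, hy⟩ := exists_path_of_triangle hβ hη x (i := u) (p := v) (q := p)
      (by rw [hxv, Finset.pair_comm]) (by rw [hxp, Finset.pair_comm])
    have hT : Triangles y {v, p, u} :=
      triangles_triple (by rw [hy v hvne, hxv]) (by rw [hy p hpne, hxp]) hyu
    have hd := disjoint_triple hvR hpR hu
    have hy' : ∀ k, k ∉ ({v, p, u} : Finset V) → y k = x k := fun k hk => hy k (by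
      rintro rfl; simp at hk)
    have hRT := hR.1.extend hT hd hy'
    obtain ⟨z, S, hyz, hz⟩ := ih _ (card_compl_union_lt hd (by simp)) y _ rfl ⟨hRT, by
      intro w t ht htR
      have hwR : w ∉ R ∪ {v, p, u} := fun h => htR (hRT.closed h ht).1
      have hwR' := hwR
      simp only [Finset.mem_union, Finset.mem_insert, Finset.mem_singleton, not_or] at htR hwR'
      rw [hy w hwR'.2.2.2] at ht
      rw [hy t htR.2.2.2]
      refine (hR.2 w t ht htR.1).imp id (Or.imp (fun h => h.extend hRT hy' hwR) ?_)
      rintro ⟨q, hxw, hxq, hqt, hwt⟩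
      -- Other shortcuts survive: if `q = u`, then `p`, a target of `u`, would be `w` or `t`, but
      -- these lie outside of the new triangle.
      have hqu : q ≠ u := by
        rintro rfl
        simp only [hxq, Finset.mem_insert, Finset.mem_singleton] at hpu
        rcases hpu with h | h
        · exact hwR'.2.2.1 h.symm
        · exact htR.2.2.1 h.symm
      exact ⟨q, by rw [hy w hwR'.2.2.2, hxw], by rw [hy q hqu, hxq], by rwa [hy t htR.2.2.2],
        by rwa [hy t htR.2.2.2]⟩⟩
    exact ⟨z, S, hxy.trans hyz, hz⟩
  · push Not at hs
    exact ⟨x, R, Relation.ReflTransGen.refl, hR.1, fun v u hu huR =>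
      (hR.2 v u hu huR).imp id (Or.resolve_right · (hs v u huR))⟩

theorem mem_links_of_forall_hit_le (hβ : β ∈ Set.Ioo (0 : ℝ) 1) {x : Config₂ V} {i k : V}
    (hk : k ≠ i) (hpos : 0 < hit β x i k) (hmax : ∀ m, m ≠ i → hit β x i m ≤ hit β x i k) :
    i ∈ (x k).1 := by
  by_contra hi
  obtain ⟨p, q, hpq, hxk⟩ := exists_links_eq x k
  have hp := hmax p (by rintro rfl; simp [hxk] at hi)
  have hq := hmax q (by rintro rfl; simp [hxk] at hi)
  have := hit_eq_pair hβ hk hxk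
  have := hβ.1
  have := hβ.2
  nlinarith

/-- The links of a Nash equilibrium. -/
theorem isShortcutCore_of_isNash (hβ : β ∈ Set.Ioo (0 : ℝ) 1) (hη : ∀ i, 0 < η i)
    {x : Config₂ V} (hx : Game.IsNash (utility (fun _ => 2) β η) x) : IsShortcutCore x ∅ := by
  have h1 := hβ.1
  have h2 := hβ.2
  have hN : ∀ i, ∀ p ∈ (x i).1, ∀ q, q ∉ (x i).1 → q ≠ i → hit β x i q ≤ hit β x i p := fun i =>
    (mem_bestResponses_iff_exchange hβ hη x i (x i)).1 (hx i)
  refine ⟨triangles_empty x, fun v u hu _ => ?_⟩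
  by_contra! hcon
  obtain ⟨hvu, hns, hnsh⟩ := hcon
  obtain ⟨w, hw⟩ : ∃ w, v ∈ (x w).1 := by
    by_contra! h; exact hns (Or.inl h)
  have huv : u ≠ v := ne_of_mem_links hu
  obtain ⟨p, hpu, hxv⟩ := exists_other hu
  have hpv : p ≠ v := ne_of_mem_links (x := x) (by simp [hxv])
  have hNv : ∀ q, q ≠ v → q ≠ u → q ≠ p → hit β x v q ≤ hit β x v u ∧ hit β x v q ≤ hit β x v p :=
    fun q hqv hqu hqp => ⟨hN v u hu q (by simp [hxv, hqu, hqp]) hqv,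
      hN v p (by simp [hxv]) q (by simp [hxv, hqu, hqp]) hqv⟩
  have hwpos := hit_pos hβ hw
  have hwv : w ≠ v := (ne_of_mem_links hw).symm
  have hup : hit β x v u ≤ hit β x v p := by
    -- Otherwise `u` would be the best node for `v`, hence link to `v`.
    by_contra! h
    refine hvu (mem_links_of_forall_hit_le hβ huv ((hit_nonneg hβ x v p).trans_lt h) fun m hm => ?_)
    by_cases hmu : m = u
    · rw [hmu]
    by_cases hmp : m = p
    · rw [hmp]; exact h.le
    exact (hNv m hm hmu hmp).1
  have hmax : ∀ m, m ≠ v → hit β x v m ≤ hit β x v p := by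
    intro m hm
    by_cases hmu : m = u
    · rw [hmu]; exact hup
    by_cases hmp : m = p
    · rw [hmp]
    exact (hNv m hm hmu hmp).2
  have hvp : v ∈ (x p).1 :=
    mem_links_of_forall_hit_le hβ hpv (hwpos.trans_le (hmax w hwv)) hmax
  rcases (hit_nonneg hβ x v u).eq_or_lt with h0 | hupos
  -- If `u` cannot reach `v`, optimality of `u` as a target means that only `p` can, and `v`, `p`
  -- form a source clique.
  · have hzero : ∀ k, k ≠ v → 0 < hit β x v k → k = p := by
      intro k hk hpos
      by_contra hkp
      by_cases hku : k = u
      · rw [hku, ← h0] at hpos; exact lt_irrefl _ hpos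
      · have := (hNv k hk hku hkp).1
        linarith
    refine hns (Or.inr ⟨p, by simp [hxv], hvp, fun k hk => hzero k (ne_of_mem_links hk).symm
      (hit_pos hβ hk), fun k hk => ?_⟩)
    by_contra hkv
    have := hzero k hkv (hit_pos_of_mem hβ hkv hk (hit_pos hβ hvp))
    subst this
    exact notMem_links x k hk
  -- Otherwise both targets of `u` have value at most that of `u`, which is impossible for a
  -- positive value.
  · have hpxu : p ∈ (x u).1 := by
      by_contra hpu'
      obtain ⟨c, d, -, hxu⟩ := exists_links_eq x u
      have hle : ∀ m ∈ (x u).1, hit β x v m ≤ hit β x v u := fun m hm =>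
        (hNv m (by rintro rfl; exact hvu hm) (ne_of_mem_links hm)
          (by rintro rfl; exact hpu' hm)).1
      have hc := hle c (by simp [hxu])
      have hd := hle d (by simp [hxu])
      have := hit_eq_pair hβ huv hxu
      nlinarith
    obtain ⟨t, htv, hxp⟩ := exists_other hvp
    by_cases htu : t = u
    · subst htu
      exact hnsh ⟨p, by rw [hxv, Finset.pair_comm], hxp, hpxu, hvu⟩
    -- For player `u`, the node `v` links to `u` and `p`, while `p` links to `v` and to `t`, of
    -- value below `1`. So `v` is strictly better than `p`, although `u` chose `p` and not `v`.
    · have e1 := hN u p hpxu v hvu huv.symm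
      have e2 := hit_eq_pair hβ huv.symm hxv
      have e3 := hit_eq_pair hβ hpu hxp
      rw [hit_self hβ] at e2
      have e4 := hit_lt_one hβ x htu
      nlinarith

/-- Every Nash equilibrium can be turned into undirected rings or into triangles with a clique. -/
theorem exists_path_of_isNash (hβ : β ∈ Set.Ioo (0 : ℝ) 1) (hη : ∀ i, 0 < η i)
    {x : Config₂ V} (hx : Game.IsNash (utility (fun _ => 2) β η) x) :
    ∃ y, BRPath β η x y ∧ (IsMutual y ∨ IsTrianglesWithClique y) := by
  have main : ∀ (z : Config₂ V) (S : Finset V), S.Nonempty → BRPath β η x z → IsSourceCore z S →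
      ∃ y, BRPath β η x y ∧ (IsMutual y ∨ IsTrianglesWithClique y) := by
    intro z S hS hxz hz
    obtain ⟨w, hzw, hw⟩ := exists_path_isCore_of_isSourceCore hβ hη hS _ z rfl hz
    obtain ⟨y, hwy, hy⟩ := exists_path_of_isCore hβ hη _ w S rfl hw
    exact ⟨y, (hxz.trans hzw).trans hwy, hy⟩
  obtain ⟨z, S, hxz, hz⟩ := exists_path_isSourceCore_of_isShortcutCore hβ hη _ x ∅ rfl
    (isShortcutCore_of_isNash hβ hη hx)
  rcases S.eq_empty_or_nonempty with rfl | hS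
  · obtain ⟨w, hzw, hw | ⟨S, hS, hw⟩⟩ := exists_path_isSourceCore_nonempty hβ hη hz
    · exact ⟨w, hxz.trans hzw, Or.inl hw⟩
    · exact main w S hS (hxz.trans hzw) hw
  · exact main z S hS hxz hz

end CentralityGame

/-! ### Stability of the recurrent configurations under best responses -/

namespace CentralityGame

variable {V : Type*} [DecidableEq V]

/-- `x` consists of triangles and of two further triangles `c a b` and `c r s` with a common node
`c`, two of whose four links are missing at `c`. -/
structure IsBowTie [Fintype V] (x : Config₂ V) (c a b r s : V) : Prop where
  links_a : (x a).1 = {b, c}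
  links_b : (x b).1 = {a, c}
  links_r : (x r).1 = {s, c}
  links_s : (x s).1 = {r, c}
  links_c : ∀ k ∈ (x c).1, k = a ∨ k = b ∨ k = r ∨ k = s
  ne_ar : a ≠ r
  ne_as : a ≠ s
  ne_br : b ≠ r
  ne_bs : b ≠ s
  triangles : Triangles x ({c, a, b, r, s}ᶜ)

/-- `x` consists of triangles and of one butterfly. -/
def IsTrianglesWithButterfly [Fintype V] (x : Config₂ V) : Prop :=
  ∃ c a b r s, IsBowTie x c a b r s ∧ (x c).1 = {a, r}

variable [Fintype V] {β : ℝ} {η : V → ℝ}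

namespace IsBowTie

variable {x : Config₂ V} {c a b r s : V}

theorem flip (h : IsBowTie x c a b r s) : IsBowTie x c b a r s where
  links_a := h.links_b
  links_b := h.links_a
  links_r := h.links_r
  links_s := h.links_s
  links_c k hk := by have := h.links_c k hk; tauto
  ne_ar := h.ne_br
  ne_as := h.ne_bs
  ne_br := h.ne_ar
  ne_bs := h.ne_as
  triangles := by
    have := h.triangles
    rwa [show ({c, b, a, r, s} : Finset V) = {c, a, b, r, s} by ext; simp; tauto]

theorem swap (h : IsBowTie x c a b r s) : IsBowTie x c r s a b where
  links_a := h.links_r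
  links_b := h.links_s
  links_r := h.links_a
  links_s := h.links_b
  links_c k hk := by have := h.links_c k hk; tauto
  ne_ar := h.ne_ar.symm
  ne_as := h.ne_br.symm
  ne_br := h.ne_as.symm
  ne_bs := h.ne_bs.symm
  triangles := by
    have := h.triangles
    rwa [show ({c, r, s, a, b} : Finset V) = {c, a, b, r, s} by ext; simp; tauto]

theorem ne_ca (h : IsBowTie x c a b r s) : c ≠ a :=
  ne_of_mem_links (x := x) (by simp [h.links_a])

theorem ne_ba (h : IsBowTie x c a b r s) : b ≠ a :=
  ne_of_mem_links (x := x) (by simp [h.links_a])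

/-- The nodes that link to `c`. -/
theorem mem_links_iff (h : IsBowTie x c a b r s) (k : V) :
    c ∈ (x k).1 ↔ k = a ∨ k = b ∨ k = r ∨ k = s := by
  constructor
  · intro hk
    by_contra! hne
    have hkc : k ≠ c := by rintro rfl; exact notMem_links x _ hk
    have := (h.triangles.closed (j := k) (by simp [hkc, hne]) hk).1
    simp at this
  · rintro (rfl | rfl | rfl | rfl) <;> simp [h.links_a, h.links_b, h.links_r, h.links_s]

/-- The maximum requires a link to `c`, and each wing attains it. So `c` is indifferent among all
pairs of wing nodes. -/
theorem hit_eq_max_iff (h : IsBowTie x c a b r s) (hβ : β ∈ Set.Ioo (0 : ℝ) 1) {k : V}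
    (hk : k ≠ c) : hit β x c k = β / (2 - β) ↔ k = a ∨ k = b ∨ k = r ∨ k = s := by
  constructor
  · intro hM
    exact (h.mem_links_iff k).1 (mem_of_hit_eq_max hβ hk hM).1
  · have key : ∀ {a b r s : V}, IsBowTie x c a b r s → hit β x c a = β / (2 - β) := fun h =>
      hit_eq_max hβ (h.links_a.trans (Finset.pair_comm _ _))
        (h.links_b.trans (Finset.pair_comm _ _))
    rintro (rfl | rfl | rfl | rfl)
    · exact key h
    · exact key h.flip
    · exact key h.swap
    · exact key h.swap.flip

/-- If both links of `c` go to one wing, that wing and `c` form a triangle and the other wing is a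
source clique; if they go to different wings, the graph is a butterfly. -/
theorem classify (h : IsBowTie x c a b r s) :
    IsTrianglesWithClique x ∨ IsTrianglesWithButterfly x := by
  have hclique : ∀ {a b r s : V}, IsBowTie x c a b r s → r ∉ (x c).1 → s ∉ (x c).1 →
      IsTrianglesWithClique x := by
    intro a b r s h hr hs
    have hc : (x c).1 = {a, b} := by
      apply Finset.eq_of_subset_of_card_le
      · intro k hk
        rcases h.links_c k hk with rfl | rfl | rfl | rfl
        · simp
        · simp
        · contradiction
        · contradiction
      · rw [card_links]; exact Finset.card_le_two
    refine ⟨r, s, h.swap.ne_ba.symm, by simp [h.links_r], by simp [h.links_s], ?_⟩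
    have := h.triangles.union (triangles_triple hc (h.links_a.trans (Finset.pair_comm _ _))
      (h.links_b.trans (Finset.pair_comm _ _)))
    convert this using 1
    have h1 := h.ne_ar
    have h2 := h.ne_as
    have h3 := h.ne_br
    have h4 := h.ne_bs
    have h5 := h.swap.ne_ca
    have h6 := h.swap.flip.ne_ca
    ext k
    simp only [Finset.mem_compl, Finset.mem_insert, Finset.mem_singleton, Finset.mem_union]
    grind
  by_cases hr : r ∈ (x c).1
  · by_cases ha : a ∈ (x c).1
    · exact Or.inr ⟨c, a, b, r, s, h, links_eq_pair ha hr h.ne_ar⟩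
    · by_cases hb : b ∈ (x c).1
      · exact Or.inr ⟨c, b, a, r, s, h.flip, links_eq_pair hb hr h.ne_br⟩
      · exact Or.inl (hclique h.swap ha hb)
  · by_cases hs : s ∈ (x c).1
    · by_cases ha : a ∈ (x c).1
      · exact Or.inr ⟨c, a, b, s, r, h.swap.flip.swap, links_eq_pair ha hs h.ne_as⟩
      · by_cases hb : b ∈ (x c).1
        · exact Or.inr ⟨c, b, a, s, r, h.flip.swap.flip.swap, links_eq_pair hb hs h.ne_bs⟩
        · exact Or.inl (hclique h.swap ha hb)
    · exact Or.inl (hclique h hr hs)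

end IsBowTie

/-- Two nodes already attain the universal bound, so a best response cannot contain a node below it.
-/
theorem mem_bestResponses_iff_of_max (hβ : β ∈ Set.Ioo (0 : ℝ) 1) (hη : ∀ i, 0 < η i)
    {x : Config₂ V} {i p q : V} (hpi : p ≠ i) (hqi : q ≠ i) (hpq : p ≠ q)
    (hp : hit β x i p = β / (2 - β)) (hq : hit β x i q = β / (2 - β))
    (α : Action (fun _ => 2) i) :
    α ∈ Game.bestResponses (utility (fun _ => 2) β η) i x ↔
      ∀ k ∈ α.1, hit β x i k = β / (2 - β) := by
  rw [mem_bestResponses_iff_exchange hβ hη]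
  constructor
  · intro h k hk
    have hki : k ≠ i := by rintro rfl; exact α.2.1 hk
    apply le_antisymm (hit_le_max hβ x hki)
    by_cases hpα : p ∈ α.1
    · by_cases hqα : q ∈ α.1
      · have : ({p, q} : Finset V) = α.1 := by
          apply Finset.eq_of_subset_of_card_le
          · intro m hm
            simp only [Finset.mem_insert, Finset.mem_singleton] at hm
            rcases hm with rfl | rfl <;> assumption
          · rw [α.2.2, Finset.card_pair hpq]
        rw [← this] at hk
        simp only [Finset.mem_insert, Finset.mem_singleton] at hk
        rcases hk with rfl | rfl
        · exact hp.ge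
        · exact hq.ge
      · rw [← hq]; exact h k hk q hqα hqi
    · rw [← hp]; exact h k hk p hpα hpi
  · intro h k hk m _ hmi
    rw [h k hk]
    exact hit_le_max hβ x hmi

/-- The nodes of a triangle that receives no other links play strict best responses. -/
theorem bestResponses_eq_of_triangle (hβ : β ∈ Set.Ioo (0 : ℝ) 1) (hη : ∀ i, 0 < η i)
    {x : Config₂ V} {j p q : V} (hp : (x p).1 = {j, q}) (hq : (x q).1 = {j, p})
    (hj : (x j).1 = {p, q}) (hin : ∀ u, j ∈ (x u).1 → u ∈ (x j).1) :
    Game.bestResponses (utility (fun _ => 2) β η) j x = {x j} := by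
  refine bestResponses_eq_singleton hβ hη fun k hk m hm hmj => ?_
  have : hit β x j k = β / (2 - β) := by
    simp only [hj, Finset.mem_insert, Finset.mem_singleton] at hk
    rcases hk with rfl | rfl
    · exact hit_eq_max hβ hp hq
    · exact hit_eq_max hβ hq hp
  rw [this]
  exact lt_of_le_of_ne (hit_le_max hβ x hmj) fun h => hm (hin m (mem_of_hit_eq_max hβ hmj h).1)

omit [Fintype V] in
theorem Triangles.sdiff {x : Config₂ V} {R T : Finset V} (hR : Triangles x R)
    (hT : Triangles x T) : Triangles x (R \ T) := by
  intro j hj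
  rw [Finset.mem_sdiff] at hj
  obtain ⟨a, ha, b, hb, hab, hxj, hxa, hxb⟩ := hR j hj.1
  exact ⟨a, Finset.mem_sdiff.2 ⟨ha, fun h => hj.2 (hT.closed h (by simp [hxa])).1⟩,
    b, Finset.mem_sdiff.2 ⟨hb, fun h => hj.2 (hT.closed h (by simp [hxb])).1⟩, hab, hxj, hxa, hxb⟩

omit [Fintype V] in
theorem eq_of_eq_at {x y : Config₂ V} {i : V} (hi : y i = x i) (h : ∀ k, k ≠ i → y k = x k) :
    y = x := by
  funext k
  by_cases hk : k = i
  · rw [hk, hi]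
  · exact h k hk

/-! ### Triangles with a clique -/

section Clique

variable {x : Config₂ V} {r s : V}

theorem Triangles.eq_of_mem_links (hT : Triangles x ({r, s}ᶜ)) (hs : s ∈ (x r).1) :
    ∀ u, r ∈ (x u).1 → u = s := by
  intro u hu
  by_contra hus
  have hur : u ≠ r := by rintro rfl; exact notMem_links x _ hu
  have := (hT.closed (j := u) (by simp [hur, hus]) hu).1
  simp at this

theorem isNash_of_isTrianglesWithClique (hβ : β ∈ Set.Ioo (0 : ℝ) 1) (hη : ∀ i, 0 < η i)
    (hx : IsTrianglesWithClique x) : Game.IsNash (utility (fun _ => 2) β η) x := by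
  obtain ⟨r, s, hrs, hs, hr, hT⟩ := hx
  have hT' : Triangles x ({s, r}ᶜ) := by rwa [Finset.pair_comm]
  have key : ∀ {r s : V}, r ≠ s → s ∈ (x r).1 → r ∈ (x s).1 → Triangles x ({r, s}ᶜ) →
      Triangles x ({s, r}ᶜ) → x r ∈ Game.bestResponses (utility (fun _ => 2) β η) r x := by
    intro r s hrs hs hr hT hT'
    rw [mem_bestResponses_iff_exchange hβ hη]
    intro p hp q hq hqr
    rw [hit_eq_zero_of_clique hβ x (hT.eq_of_mem_links hs) (hT'.eq_of_mem_links hr) hqr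
      (by rintro rfl; contradiction)]
    exact hit_nonneg hβ x r p
  intro i
  by_cases hir : i = r
  · subst hir; exact key hrs hs hr hT hT'
  by_cases his : i = s
  · subst his; exact key hrs.symm hr hs hT' hT
  obtain ⟨p, hp, q, hq, hpq, hxi, hxp, hxq⟩ := hT i (by simp [hir, his])
  have h1 := hit_eq_max hβ hxp hxq
  have h2 := hit_eq_max hβ hxq hxp
  rw [mem_bestResponses_iff_of_max hβ hη (ne_of_mem_links (x := x) (by simp [hxi]))
    (ne_of_mem_links (x := x) (by simp [hxi])) hpq h1 h2]
  intro k hk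
  simp only [hxi, Finset.mem_insert, Finset.mem_singleton] at hk
  rcases hk with rfl | rfl <;> assumption

/-- A clique node keeps its partner, the only node of positive value, and may move its other link. A
triangle node can deviate only if both clique nodes point to it, which makes a bow tie. -/
theorem bestResponse_of_isTrianglesWithClique (hβ : β ∈ Set.Ioo (0 : ℝ) 1) (hη : ∀ i, 0 < η i)
    (hx : IsTrianglesWithClique x) {y : Config₂ V} {i : V}
    (hyi : y i ∈ Game.bestResponses (utility (fun _ => 2) β η) i x) (hy : ∀ k, k ≠ i → y k = x k) :
    IsTrianglesWithClique y ∨ IsTrianglesWithButterfly y := by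
  obtain ⟨r, s, hrs, hs, hr, hT⟩ := hx
  have hT' : Triangles x ({s, r}ᶜ) := by rwa [Finset.pair_comm]
  have key : ∀ {r s : V}, r ≠ s → s ∈ (x r).1 → r ∈ (x s).1 → Triangles x ({r, s}ᶜ) →
      Triangles x ({s, r}ᶜ) → i = r → IsTrianglesWithClique y := by
    rintro r s hrs hs hr hT hT' rfl
    refine ⟨i, s, hrs, ?_, by rwa [hy s hrs.symm], hT.congr fun v hv => hy v ?_⟩
    · rw [mem_bestResponses_iff_exchange hβ hη] at hyi
      by_contra hsy
      obtain ⟨p, q, -, hyp⟩ := exists_links_eq y i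
      have hps : p ≠ s := by rintro rfl; simp [hyp] at hsy
      have := hyi p (by simp [hyp]) s hsy hrs.symm
      rw [hit_eq_zero_of_clique hβ x (hT.eq_of_mem_links hs) (hT'.eq_of_mem_links hr)
        (ne_of_mem_links (x := y) (by simp [hyp])) hps] at this
      exact absurd this (not_le.2 (hit_pos hβ hr))
    · rintro rfl; simp at hv
  by_cases hir : i = r
  · exact Or.inl (key hrs hs hr hT hT' hir)
  by_cases his : i = s
  · exact Or.inl (key hrs.symm hr hs hT' hT his)
  obtain ⟨p, hp, q, hq, hpq, hxi, hxp, hxq⟩ := hT i (by simp [hir, his])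
  have hpi : p ≠ i := ne_of_mem_links (x := x) (by simp [hxi])
  have hqi : q ≠ i := ne_of_mem_links (x := x) (by simp [hxi])
  simp only [Finset.mem_compl, Finset.mem_insert, Finset.mem_singleton, not_or] at hp hq
  rw [mem_bestResponses_iff_of_max hβ hη hpi hqi hpq (hit_eq_max hβ hxp hxq)
    (hit_eq_max hβ hxq hxp)] at hyi
  have hin : ∀ k ∈ (y i).1, k = p ∨ k = q ∨ k = r ∨ k = s := by
    intro k hk
    have hki := (mem_of_hit_eq_max hβ (ne_of_mem_links hk) (hyi k hk)).1
    by_cases hkrs : k = r ∨ k = s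
    · tauto
    · have := (hT.closed (j := k) (by simpa using hkrs) hki).2
      simp only [hxi, Finset.mem_insert, Finset.mem_singleton] at this
      tauto
  -- A node of maximal value links to `i` and to another node of maximal value; for `r` the latter
  -- must be `s`.
  have bow : ∀ {r s : V}, s ∈ (x r).1 → r ∈ (x s).1 → i ≠ r → i ≠ s →
      r ∈ (y i).1 → (x r).1 = {s, i} ∧ (x s).1 = {r, i} := by
    intro r s hs hr hir his hry
    have h1 := mem_of_hit_eq_max hβ hir.symm (hyi r hry)
    have h2 := mem_of_hit_eq_max hβ his.symm (h1.2 s hs his.symm)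
    exact ⟨links_eq_pair hs h1.1 his.symm, links_eq_pair hr h2.1 hir.symm⟩
  by_cases hrsy : r ∈ (y i).1 ∨ s ∈ (y i).1
  · have hrs' : (x r).1 = {s, i} ∧ (x s).1 = {r, i} := by
      rcases hrsy with h | h
      · exact bow hs hr hir his h
      · exact (bow hr hs his hir h).symm
    have hB : IsBowTie y i p q r s := by
      refine ⟨?_, ?_, ?_, ?_, hin, hp.1, hp.2, hq.1, hq.2, ?_⟩
      · rw [hy p hpi, hxp, Finset.pair_comm]
      · rw [hy q hqi, hxq, Finset.pair_comm]
      · rw [hy r (Ne.symm hir), hrs'.1]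
      · rw [hy s (Ne.symm his), hrs'.2]
      · have := hT.sdiff (triangles_triple hxi hxp hxq)
        have e : ({i, p, q, r, s}ᶜ : Finset V) = {r, s}ᶜ \ {i, p, q} := by
          ext k
          simp only [Finset.mem_compl, Finset.mem_insert, Finset.mem_singleton, Finset.mem_sdiff]
          tauto
        rw [e]
        refine this.congr fun v hv => hy v ?_
        rintro rfl
        simp at hv
    exact hB.classify
  · push Not at hrsy
    have hyi' : y i = x i := by
      apply Subtype.ext
      apply Finset.eq_of_subset_of_card_le
      · intro k hk
        rw [hxi]
        rcases hin k hk with rfl | rfl | rfl | rfl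
        · simp
        · simp
        · exact absurd hk hrsy.1
        · exact absurd hk hrsy.2
      · rw [card_links, card_links]
    rw [eq_of_eq_at hyi' hy]
    exact Or.inl ⟨r, s, hrs, hs, hr, hT⟩

end Clique

/-! ### Triangles with a butterfly -/

section Butterfly

variable {x : Config₂ V}

/-- For `a`, the nodes `r` and `s` have equal values and reach `a` only through `c`, so they are
strictly worse than `c`. They are also worse than `b`, which links to `a` itself. The triangles have
value `0`. -/
theorem IsBowTie.bestResponses_wing {c a b r s : V} (hβ : β ∈ Set.Ioo (0 : ℝ) 1)
    (hη : ∀ i, 0 < η i) (h : IsBowTie x c a b r s) (hc : 0 < hit β x a c) :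
    Game.bestResponses (utility (fun _ => 2) β η) a x = {x a} := by
  have h1 := hβ.1
  have h2 := hβ.2
  have hb := hit_eq_pair hβ h.ne_ba h.links_b
  have hr := hit_eq_pair hβ h.ne_ar.symm h.links_r
  have hs := hit_eq_pair hβ h.ne_as.symm h.links_s
  have hs1 := hit_lt_one hβ x h.ne_as.symm
  rw [hit_self hβ] at hb
  have hrs : hit β x a r = hit β x a s := by
    have : (hit β x a r - hit β x a s) * (1 + β / 2) = 0 := by linarith
    rcases mul_eq_zero.1 this with h | h <;> linarith
  have hrc : hit β x a r < hit β x a c := by nlinarith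
  have hrb : hit β x a r < hit β x a b := by nlinarith
  have hpos : 0 < hit β x a b := by nlinarith
  have key : ∀ m, m ∉ (x a).1 → m ≠ a → hit β x a m < hit β x a b ∧ hit β x a m < hit β x a c := by
    intro m hm hma
    simp only [h.links_a, Finset.mem_insert, Finset.mem_singleton, not_or] at hm
    by_cases hmr : m = r
    · subst hmr; exact ⟨hrb, hrc⟩
    by_cases hms : m = s
    · subst hms; rw [← hrs]; exact ⟨hrb, hrc⟩
    have : hit β x a m = 0 := by
      refine hit_eq_zero_of_closed hβ (↑({c, a, b, r, s}ᶜ : Finset V)) (by simp) ?_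
        (by simp [hm.1, hm.2, hma, hmr, hms])
      exact fun k hk m hm => (h.triangles.closed hk hm).1
    rw [this]
    exact ⟨hpos, hc⟩
  refine bestResponses_eq_singleton hβ hη fun k hk m hm hma => ?_
  simp only [h.links_a, Finset.mem_insert, Finset.mem_singleton] at hk
  rcases hk with rfl | rfl
  · exact (key m hm hma).1
  · exact (key m hm hma).2

theorem IsBowTie.bestResponses_butterfly {c a b r s : V} (hβ : β ∈ Set.Ioo (0 : ℝ) 1)
    (hη : ∀ i, 0 < η i) (h : IsBowTie x c a b r s) (hc : (x c).1 = {a, r}) {i : V} (hi : i ≠ c) :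
    Game.bestResponses (utility (fun _ => 2) β η) i x = {x i} := by
  have wing : ∀ {a b r s : V}, IsBowTie x c a b r s → a ∈ (x c).1 → i = a ∨ i = b →
      Game.bestResponses (utility (fun _ => 2) β η) i x = {x i} := by
    rintro a b r s h ha (rfl | rfl)
    · exact h.bestResponses_wing hβ hη (hit_pos hβ ha)
    · exact h.flip.bestResponses_wing hβ hη
        (hit_pos_of_mem hβ h.flip.ne_ca ha (hit_pos hβ (by simp [h.links_a])))
  by_cases hiab : i = a ∨ i = b
  · exact wing h (by simp [hc]) hiab
  by_cases hirs : i = r ∨ i = s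
  · exact wing h.swap (by simp [hc]) hirs
  push Not at hiab hirs
  obtain ⟨p, hp, q, hq, hpq, hxi, hxp, hxq⟩ := h.triangles i (by simp [hi, hiab, hirs])
  refine bestResponses_eq_of_triangle hβ hη hxp hxq hxi fun u hu => ?_
  refine (h.triangles.closed (j := u) ?_ hu).2
  simp only [Finset.mem_compl, Finset.mem_insert, Finset.mem_singleton]
  rintro (rfl | rfl | rfl | rfl | rfl)
  · simp [hc, hiab, hirs] at hu
  · simp [h.links_a, hiab, hi] at hu
  · simp [h.links_b, hiab, hi] at hu
  · simp [h.links_r, hirs, hi] at hu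
  · simp [h.links_s, hirs, hi] at hu

theorem IsBowTie.mem_bestResponses_iff {c a b r s : V} (hβ : β ∈ Set.Ioo (0 : ℝ) 1)
    (hη : ∀ i, 0 < η i) (h : IsBowTie x c a b r s) (α : Action (fun _ => 2) c) :
    α ∈ Game.bestResponses (utility (fun _ => 2) β η) c x ↔
      ∀ k ∈ α.1, k = a ∨ k = b ∨ k = r ∨ k = s := by
  rw [mem_bestResponses_iff_of_max hβ hη h.ne_ca.symm h.flip.ne_ca.symm h.ne_ba.symm
    ((h.hit_eq_max_iff hβ h.ne_ca.symm).2 (by simp))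
    ((h.hit_eq_max_iff hβ h.flip.ne_ca.symm).2 (by simp))]
  refine forall₂_congr fun k hk => h.hit_eq_max_iff hβ ?_
  rintro rfl
  exact α.2.1 hk

theorem isNash_of_isTrianglesWithButterfly (hβ : β ∈ Set.Ioo (0 : ℝ) 1) (hη : ∀ i, 0 < η i)
    (hx : IsTrianglesWithButterfly x) : Game.IsNash (utility (fun _ => 2) β η) x := by
  obtain ⟨c, a, b, r, s, h, hc⟩ := hx
  intro i
  by_cases hi : i = c
  · subst hi
    exact (h.mem_bestResponses_iff hβ hη (x i)).2 h.links_c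
  · rw [h.bestResponses_butterfly hβ hη hc hi]
    exact Set.mem_singleton _

theorem bestResponse_of_isTrianglesWithButterfly (hβ : β ∈ Set.Ioo (0 : ℝ) 1)
    (hη : ∀ i, 0 < η i) (hx : IsTrianglesWithButterfly x) {y : Config₂ V} {i : V}
    (hyi : y i ∈ Game.bestResponses (utility (fun _ => 2) β η) i x) (hy : ∀ k, k ≠ i → y k = x k) :
    IsTrianglesWithClique y ∨ IsTrianglesWithButterfly y := by
  obtain ⟨c, a, b, r, s, h, hc⟩ := hx
  by_cases hi : i = c
  · subst hi
    rw [h.mem_bestResponses_iff hβ hη] at hyi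
    have : IsBowTie y i a b r s := by
      refine ⟨?_, ?_, ?_, ?_, hyi, h.ne_ar, h.ne_as, h.ne_br, h.ne_bs, ?_⟩
      · rw [hy a h.ne_ca.symm, h.links_a]
      · rw [hy b h.flip.ne_ca.symm, h.links_b]
      · rw [hy r h.swap.ne_ca.symm, h.links_r]
      · rw [hy s h.swap.flip.ne_ca.symm, h.links_s]
      · refine h.triangles.congr fun v hv => hy v ?_
        rintro rfl
        simp at hv
    exact this.classify
  · rw [h.bestResponses_butterfly hβ hη hc hi, Set.mem_singleton_iff] at hyi
    rw [eq_of_eq_at hyi hy]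
    exact Or.inr ⟨c, a, b, r, s, h, hc⟩

end Butterfly

/-! ### Undirected configurations -/

/-- In an undirected configuration, the two neighbors of a node are symmetric. -/
theorem hit_eq_of_isMutual (hβ : β ∈ Set.Ioo (0 : ℝ) 1) {x : Config₂ V} (hx : IsMutual x)
    {j a b : V} (hj : (x j).1 = {a, b}) : hit β x j a = hit β x j b := by
  classical
  have h1 := hβ.1
  have h2 := hβ.2
  set f := hit β x j with hf
  -- The quadratic form `Q` is constant along the rings, except possibly at `j`.
  let Q : V → V → ℝ := fun u w => f u ^ 2 + f w ^ 2 - 2 / β * (f u * f w)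
  have hQs : ∀ u w, Q u w = Q w u := fun u w => by simp only [Q]; ring
  let G : SimpleGraph V :=
    { Adj := fun u w => w ∈ (x u).1 ∧ Q u w = Q j a
      symm := ⟨fun u w h => ⟨hx u w h.1, by rw [hQs]; exact h.2⟩⟩
      loopless := ⟨fun u h => notMem_links x u h.1⟩ }
  have hdeg : ∀ v, G.degree v = ((x v).1.filter fun w => Q v w = Q j a).card := by
    intro v
    rw [← SimpleGraph.card_neighborFinset_eq_degree]
    congr 1
    ext w
    simp [G]
  -- The harmonic equation at `v ≠ j` gives `Q` the same value on both links of `v`, so `v` has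
  -- degree `0` or `2` in `G`. By the handshake lemma `j` cannot be the only node of odd degree.
  have hba : Q j b = Q j a := by
    by_contra hne
    have hodd : Odd (G.degree j) := by
      rw [hdeg, hj, Finset.filter_insert, if_pos rfl, Finset.filter_singleton, if_neg hne]
      simp
    obtain ⟨v, hvj, hv⟩ := G.exists_ne_odd_degree_of_exists_odd_degree j hodd
    obtain ⟨u, w, huw, hxv⟩ := exists_links_eq x v
    have he := hit_eq_pair hβ hvj hxv
    have hQ : Q v u = Q v w := by
      simp only [Q]
      rw [← hf] at he
      rw [he]
      field_simp
      ring
    rw [hdeg, hxv, Finset.filter_insert, Finset.filter_singleton, hQ] at hv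
    split_ifs at hv with h
    · rw [Finset.card_pair huw] at hv
      exact absurd hv (by decide)
    · simp at hv
  have ha := hit_lt_one hβ x (i := j) (k := a) (ne_of_mem_links (x := x) (by simp [hj]))
  have hb := hit_lt_one hβ x (i := j) (k := b) (ne_of_mem_links (x := x) (by simp [hj]))
  have hself : f j = 1 := hit_self hβ x j
  simp only [Q, hself] at hba
  rw [← hf] at ha hb
  have hc : 2 / β > 2 := by
    rw [gt_iff_lt, lt_div_iff₀ h1]; linarith
  -- The second factor is negative, because `f a + f b < 2 < 2 / β`.
  have : (f a - f b) * (f a + f b - 2 / β) = 0 := by linarith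
  rcases mul_eq_zero.1 this with h | h
  · linarith
  · linarith

/-- Walks reach `j` through its neighbours `a` and `b`, whose equal value is thus maximal. A node
that does not link to `j` loses a further factor `β`. -/
theorem isStrictNash_of_isMutual (hβ : β ∈ Set.Ioo (0 : ℝ) 1) (hη : ∀ i, 0 < η i)
    {x : Config₂ V} (hx : IsMutual x) : Game.IsStrictNash (utility (fun _ => 2) β η) x := by
  intro j
  have h1 := hβ.1
  have h2 := hβ.2
  obtain ⟨a, b, hab, hj⟩ := exists_links_eq x j
  have hsym := hit_eq_of_isMutual hβ hx hj
  have hpos : 0 < hit β x j a := hit_pos hβ (hx j a (by simp [hj]))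
  have hle : ∀ m, m ≠ j → m ≠ a → m ≠ b → hit β x j m ≤ hit β x j a := by
    intro m hmj hma hmb
    refine hit_le_of_closed hβ {k | k ≠ j ∧ k ≠ a ∧ k ≠ b} hpos.le (by simp) ?_ m ⟨hmj, hma, hmb⟩
    intro k hk m hm
    by_cases hma : m = a
    · right; rw [hma]
    by_cases hmb : m = b
    · right; rw [hmb, hsym]
    left
    refine ⟨?_, hma, hmb⟩
    rintro rfl
    have := hx k m hm
    simp [hj, hk.2.1, hk.2.2] at this
  have hle' : ∀ m, m ≠ j → hit β x j m ≤ hit β x j a := by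
    intro m hmj
    by_cases hma : m = a
    · rw [hma]
    by_cases hmb : m = b
    · rw [hmb, hsym]
    exact hle m hmj hma hmb
  have hlt : ∀ m, m ∉ (x j).1 → m ≠ j → hit β x j m < hit β x j a := by
    intro m hm hmj
    obtain ⟨p, q, hpq, hxm⟩ := exists_links_eq x m
    have hjm : j ∉ (x m).1 := fun h => hm (hx m j h)
    have hp := hle' p (by rintro rfl; simp [hxm] at hjm)
    have hq := hle' q (by rintro rfl; simp [hxm] at hjm)
    have := hit_eq_pair hβ hmj hxm
    nlinarith
  refine bestResponses_eq_singleton hβ hη fun k hk m hm hmj => ?_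
  simp only [hj, Finset.mem_insert, Finset.mem_singleton] at hk
  rcases hk with rfl | rfl
  · exact hlt m hm hmj
  · rw [← hsym]; exact hlt m hm hmj

theorem links_eq_of_isStrictNash (hβ : β ∈ Set.Ioo (0 : ℝ) 1) (hη : ∀ i, 0 < η i)
    {x : Config₂ V} (hx : Game.IsStrictNash (utility (fun _ => 2) β η) x) {i p q : V}
    (hpi : p ≠ i) (hqi : q ≠ i) (hpq : p ≠ q)
    (h : ∀ k, k ≠ i → k ≠ p → k ≠ q → hit β x i k ≤ hit β x i p ∧ hit β x i k ≤ hit β x i q) :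
    (x i).1 = {p, q} := by
  have ha := pair_mem_bestResponses hβ hη x hpi hqi hpq h
  rw [hx i, Set.mem_singleton_iff] at ha
  rw [← ha]

/-- A link without reverse would start at a source, which has a free link, or be a shortcut, whose
target has a best response that returns the link. -/
theorem isMutual_of_isStrictNash (hβ : β ∈ Set.Ioo (0 : ℝ) 1) (hη : ∀ i, 0 < η i)
    {x : Config₂ V} (hx : Game.IsStrictNash (utility (fun _ => 2) β η) x) : IsMutual x := by
  have hN : Game.IsNash (utility (fun _ => 2) β η) x := fun i => by rw [hx i]; rfl
  intro v u hu
  by_contra hvu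
  have hclosed : ∀ {v p q : V}, p ≠ v → q ≠ v → p ≠ q → (∀ k, k ≠ v → k ≠ p → hit β x v k = 0) →
      (x v).1 = {p, q} := by
    intro v p q hp hq hpq h0
    refine links_eq_of_isStrictNash hβ hη hx hp hq hpq fun k hk hkp _ => ?_
    rw [h0 k hk hkp]
    exact ⟨hit_nonneg hβ x v p, hit_nonneg hβ x v q⟩
  rcases ((isShortcutCore_of_isNash hβ hη hN).2 v u hu (by simp)).resolve_left hvu with
    (h | ⟨s, hs, hvs, hv', hs'⟩) | ⟨p, hxv, hxp, hpu, -⟩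
  · obtain ⟨q, hqu, hxv⟩ := exists_other hu
    -- A target of `u` provides the node for an alternative best response `{u, t}`, which misses
    -- `q`.
    obtain ⟨t, ht, htq⟩ : ∃ t ∈ (x u).1, t ≠ q := by
      obtain ⟨t, t', htt, hxu⟩ := exists_links_eq x u
      rw [hxu]
      by_cases h : t = q
      · exact ⟨t', by simp, fun h' => htt (h.trans h'.symm)⟩
      · exact ⟨t, by simp, h⟩
    have htu := ne_of_mem_links ht
    have := hclosed (v := v) (p := u) (q := t) (ne_of_mem_links hu)
      (by rintro rfl; exact h u ht) htu.symm fun k hk _ =>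
        hit_eq_zero_of_closed hβ {k | k ≠ v} (by simp) (fun k _ m hm h' => h k (h' ▸ hm)) hk
    have hq : q ∈ (x v).1 := by simp [hxv]
    simp [this, hqu, htq.symm] at hq
  · obtain ⟨t, t', htt, hxu⟩ := exists_links_eq x u
    have ht : t ∈ (x u).1 := by simp [hxu]
    have hus : u ≠ s := by rintro rfl; exact hvu hvs
    have huv := ne_of_mem_links hu
    have hts : t ≠ s := by rintro rfl; exact huv (hs' u ht)
    have := hclosed (v := v) (p := s) (q := t) (ne_of_mem_links hs)
      (by rintro rfl; exact hvu ht) hts.symm fun k hk hks =>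
        hit_eq_zero_of_clique hβ x hv' hs' hk hks
    simp [this, hus, (ne_of_mem_links ht).symm] at hu
  · have hpv : v ≠ p := (ne_of_mem_links (x := x) (by simp [hxv])).symm
    have h1 := hit_eq_max hβ (i := u) (p := v) (q := p) (by rw [hxv, Finset.pair_comm])
      (by rw [hxp, Finset.pair_comm])
    have h2 := hit_eq_max hβ (i := u) (p := p) (q := v) (by rw [hxp, Finset.pair_comm])
      (by rw [hxv, Finset.pair_comm])
    have := links_eq_of_isStrictNash hβ hη hx (i := u) (p := v) (q := p)
      (ne_of_mem_links hu).symm (ne_of_mem_links hpu) hpv fun k hk _ _ => by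
        rw [h1, h2]; exact ⟨hit_le_max hβ x hk, hit_le_max hβ x hk⟩
    simp [this] at hvu

/-- The configurations that are shown to be the recursive Nash equilibria. -/
def IsRecurrent (x : Config₂ V) : Prop :=
  IsMutual x ∨ IsTrianglesWithClique x ∨ IsTrianglesWithButterfly x

theorem IsRecurrent.isNash (hβ : β ∈ Set.Ioo (0 : ℝ) 1) (hη : ∀ i, 0 < η i)
    {x : Config₂ V} (hx : IsRecurrent x) : Game.IsNash (utility (fun _ => 2) β η) x := by
  rcases hx with hx | hx | hx
  · exact fun i => by rw [isStrictNash_of_isMutual hβ hη hx i]; rfl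
  · exact isNash_of_isTrianglesWithClique hβ hη hx
  · exact isNash_of_isTrianglesWithButterfly hβ hη hx

theorem IsRecurrent.step (hβ : β ∈ Set.Ioo (0 : ℝ) 1) (hη : ∀ i, 0 < η i)
    {x y : Config₂ V} (hx : IsRecurrent x)
    (h : Game.BestResponseStep (utility (fun _ => 2) β η) x y) : IsRecurrent y := by
  obtain ⟨-, i, hyi, hy⟩ := h
  rcases hx with hx | hx | hx
  · rw [isStrictNash_of_isMutual hβ hη hx i, Set.mem_singleton_iff] at hyi
    rw [eq_of_eq_at hyi hy]
    exact Or.inl hx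
  · exact Or.inr (bestResponse_of_isTrianglesWithClique hβ hη hx hyi hy)
  · exact Or.inr (bestResponse_of_isTrianglesWithButterfly hβ hη hx hyi hy)

omit [Fintype V] in
-- The moving player faces the same opponents before and after the step, and her old action was a
-- best response to them.
theorem bestResponseStep_symm {u : V → Config₂ V → ℝ} {x y : Config₂ V} (hx : Game.IsNash u x)
    (h : Game.BestResponseStep u x y) : Game.BestResponseStep u y x := by
  obtain ⟨hne, i, -, hy⟩ := h
  refine ⟨hne.symm, i, ?_, fun j hj => (hy j hj).symm⟩
  have : ∀ b, Function.update y i b = Function.update x i b := fun b => by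
    funext k
    by_cases hk : k = i
    · subst hk; simp
    · simp [hk, hy k hk]
  have hi := hx i
  simp only [Game.bestResponses, Set.mem_ofPred_eq, this] at hi ⊢
  exact hi

theorem IsRecurrent.path (hβ : β ∈ Set.Ioo (0 : ℝ) 1) (hη : ∀ i, 0 < η i)
    {x y : Config₂ V} (hx : IsRecurrent x) (h : BRPath β η x y) :
    IsRecurrent y ∧ BRPath β η y x := by
  induction h with
  | refl => exact ⟨hx, Relation.ReflTransGen.refl⟩
  | tail _ hstep ih =>
    exact ⟨ih.1.step hβ hη hstep,
      Relation.ReflTransGen.head (bestResponseStep_symm (ih.1.isNash hβ hη) hstep) ih.2⟩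

theorem isStrictNash_iff (hβ : β ∈ Set.Ioo (0 : ℝ) 1) (hη : ∀ i, 0 < η i) (x : Config₂ V) :
    Game.IsStrictNash (utility (fun _ => 2) β η) x ↔ IsMutual x :=
  ⟨isMutual_of_isStrictNash hβ hη, isStrictNash_of_isMutual hβ hη⟩

theorem isNash_and_isRecursive_iff (hβ : β ∈ Set.Ioo (0 : ℝ) 1) (hη : ∀ i, 0 < η i)
    (x : Config₂ V) :
    (Game.IsNash (utility (fun _ => 2) β η) x ∧
      Game.IsRecursive (utility (fun _ => 2) β η) x) ↔ IsRecurrent x := by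
  constructor
  · rintro ⟨hN, hR⟩
    obtain ⟨y, hxy, hy⟩ := exists_path_of_isNash hβ hη hN
    have hy' : IsRecurrent y := hy.imp id Or.inl
    by_cases hyx : y = x
    · exact hyx ▸ hy'
    · exact (hy'.path hβ hη (hR y hyx hxy)).1
  · intro hx
    exact ⟨hx.isNash hβ hη, fun y _ hxy => (hx.path hβ hη hxy).2⟩

end CentralityGame

/-! ### Configurations and graph families up to isomorphism -/

namespace CentralityGame

variable {V : Type*} [DecidableEq V]

/-! ### Unions of triangles -/

theorem ring_three_adj (i j : Fin 3) : (Digraph.ring 3).Adj i j ↔ i ≠ j := by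
  simp [Digraph.ring, SimpleGraph.cycleGraph_three_eq_top]

theorem threeRings_adj {m : ℕ} (p q : Σ _ : Fin m, Fin 3) :
    (Digraph.threeRings m).Adj p q ↔ p.1 = q.1 ∧ p.2 ≠ q.2 := by
  constructor
  · rintro ⟨a, v, w, h⟩
    exact ⟨rfl, (ring_three_adj v w).1 h⟩
  · obtain ⟨a, v⟩ := p
    obtain ⟨b, w⟩ := q
    rintro ⟨rfl, h⟩
    exact Digraph.DisjointUnionAdj.mk (G := fun _ : Fin m => Digraph.ring 3) a v w
      ((ring_three_adj v w).2 h)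

theorem triangles_of_threeRings {x : Config₂ V} {R : Finset V} {m : ℕ}
    (g : (Σ _ : Fin m, Fin 3) → V) (hg : Function.Injective g) (hR : ∀ v, v ∈ R ↔ ∃ q, g q = v)
    (hadj : ∀ p q, (Digraph.threeRings m).Adj p q → g q ∈ (x (g p)).1) : Triangles x R := by
  intro j hj
  obtain ⟨⟨a, i⟩, rfl⟩ := (hR j).1 hj
  have key : ∀ i₁ i₂ i₃ : Fin 3, i₁ ≠ i₂ → i₁ ≠ i₃ → i₂ ≠ i₃ →
      (x (g ⟨a, i₁⟩)).1 = {g ⟨a, i₂⟩, g ⟨a, i₃⟩} := fun i₁ i₂ i₃ h12 h13 h23 =>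
    links_eq_pair (hadj _ _ ((threeRings_adj _ _).2 ⟨rfl, h12⟩))
      (hadj _ _ ((threeRings_adj _ _).2 ⟨rfl, h13⟩)) fun h => h23 (by simpa using hg h)
  have h1 : i ≠ i + 1 := (by decide : ∀ i : Fin 3, i ≠ i + 1) i
  have h2 : i ≠ i + 2 := (by decide : ∀ i : Fin 3, i ≠ i + 2) i
  have h3 : i + 1 ≠ i + 2 := (by decide : ∀ i : Fin 3, i + 1 ≠ i + 2) i
  exact ⟨g ⟨a, i + 1⟩, (hR _).2 ⟨_, rfl⟩, g ⟨a, i + 2⟩, (hR _).2 ⟨_, rfl⟩,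
    fun h => h3 (by simpa using hg h), key _ _ _ h1 h2 h3, key _ _ _ h1.symm h3 h2,
    key _ _ _ h2.symm h3.symm h1⟩

/-- The sets `insert j (x j).1` coincide for the three nodes of a triangle and partition `R`.
Enumerating them, and the nodes of each, gives `g`. -/
theorem Triangles.exists_threeRings {x : Config₂ V} {R : Finset V} (hR : Triangles x R) :
    ∃ (m : ℕ) (g : (Σ _ : Fin m, Fin 3) → V), Function.Injective g ∧ (∀ v, v ∈ R ↔ ∃ q, g q = v) ∧
      ∀ p q, (Digraph.threeRings m).Adj p q ↔ g q ∈ (x (g p)).1 := by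
  classical
  let blocks : Finset (Finset V) := R.image fun j => insert j (x j).1
  have hblock : ∀ t ∈ blocks, t.card = 3 ∧ ∀ v ∈ t, v ∈ R ∧ t = insert v (x v).1 := by
    intro t ht
    obtain ⟨j, hj, rfl⟩ := Finset.mem_image.1 ht
    refine ⟨by rw [Finset.card_insert_of_notMem (notMem_links x j), card_links], ?_⟩
    obtain ⟨a, ha, b, hb, -, hxj, hxa, hxb⟩ := hR j hj
    intro v hv
    simp only [hxj, Finset.mem_insert, Finset.mem_singleton] at hv
    rcases hv with rfl | rfl | rfl
    · exact ⟨hj, rfl⟩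
    · exact ⟨ha, by rw [hxj, hxa, Finset.insert_comm]⟩
    · refine ⟨hb, ?_⟩
      rw [hxj, hxb]
      ext k
      simp only [Finset.mem_insert, Finset.mem_singleton]
      tauto
  let E := blocks.equivFin
  let e : ∀ t : blocks, t.1 ≃ Fin 3 := fun t => Finset.equivFinOfCardEq (hblock t.1 t.2).1
  let g : (Σ _ : Fin blocks.card, Fin 3) → V := fun q => ((e (E.symm q.1)).symm q.2).1
  have hgmem : ∀ q, g q ∈ (E.symm q.1).1 := fun q => ((e (E.symm q.1)).symm q.2).2
  have hgblock : ∀ q, g q ∈ R ∧ (E.symm q.1).1 = insert (g q) (x (g q)).1 := fun q =>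
    (hblock _ (E.symm q.1).2).2 _ (hgmem q)
  have hinj : Function.Injective g := by
    rintro ⟨a, i⟩ ⟨b, j⟩ h
    have hab : a = b := by
      apply E.symm.injective
      apply Subtype.ext
      rw [(hgblock ⟨a, i⟩).2, (hgblock ⟨b, j⟩).2, h]
    subst hab
    have : i = j := (e (E.symm a)).symm.injective (Subtype.ext h)
    rw [this]
  have hsurj : ∀ (t : blocks) (v : V), v ∈ t.1 → ∃ i, g ⟨E t, i⟩ = v := by
    intro t v hv
    refine ⟨e t ⟨v, hv⟩, ?_⟩
    simp only [g]
    rw [Equiv.symm_apply_apply, Equiv.symm_apply_apply]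
  refine ⟨blocks.card, g, hinj, ?_, ?_⟩
  · intro v
    constructor
    · intro hv
      obtain ⟨i, hi⟩ := hsurj ⟨insert v (x v).1, Finset.mem_image_of_mem _ hv⟩ v (by simp)
      exact ⟨_, hi⟩
    · rintro ⟨q, rfl⟩
      exact (hgblock q).1
  · rintro ⟨a, i⟩ ⟨b, j⟩
    rw [threeRings_adj]
    constructor
    · rintro ⟨rfl, h⟩
      have := hgmem ⟨a, j⟩
      rw [(hgblock ⟨a, i⟩).2, Finset.mem_insert] at this
      exact this.resolve_left fun h' => h (by simpa using (hinj h').symm)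
    · intro h
      have h1 : (E.symm a).1 = (E.symm b).1 := by
        have : g ⟨b, j⟩ ∈ (E.symm a).1 := by
          rw [(hgblock ⟨a, i⟩).2]; exact Finset.mem_insert_of_mem h
        rw [(hgblock ⟨b, j⟩).2]
        exact ((hblock _ (E.symm a).2).2 _ this).2
      have hab : a = b := E.symm.injective (Subtype.ext h1)
      subst hab
      refine ⟨rfl, ?_⟩
      rintro rfl
      exact notMem_links x _ h

omit [DecidableEq V] in
/-- An isomorphism from a bijection onto the nodes. -/
theorem isomorphic_of_bijective {W : Type*} {x : Config₂ V} {H : Digraph W} (f : W → V)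
    (hf : Function.Bijective f) (hadj : ∀ a b, H.Adj a b ↔ f b ∈ (x (f a)).1) :
    (graph x).Isomorphic H :=
  ⟨(RelIso.mk (Equiv.ofBijective f hf) (fun {a b} => (hadj a b).symm) :
    H.Adj ≃r (graph x).Adj).symm⟩

omit [DecidableEq V] in
theorem mem_links_iff_of_relIso {W : Type*} {x : Config₂ V} {H : Digraph W}
    (e : (graph x).Adj ≃r H.Adj) (a b : W) : e.symm b ∈ (x (e.symm a)).1 ↔ H.Adj a b :=
  e.symm.map_rel_iff

/-! ### Triangles with a clique -/

section

variable [Fintype V]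

theorem isThreeRingsWithCliqueSource_iff (x : Config₂ V) :
    (graph x).IsThreeRingsWithCliqueSource ↔ IsTrianglesWithClique x := by
  constructor
  · rintro ⟨m, t, ⟨e⟩⟩
    have h := mem_links_iff_of_relIso e
    refine ⟨e.symm (.inl 0), e.symm (.inl 1), ?_, ?_, ?_, ?_⟩
    · intro h; simpa using e.symm.injective h
    · rw [h]; simp [Digraph.cliqueSource]
    · rw [h]; simp [Digraph.cliqueSource]
    · refine triangles_of_threeRings (m := m) (fun q => e.symm (.inr q)) ?_ ?_ ?_
      · intro p q hpq
        simpa using e.symm.injective hpq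
      · intro v
        simp only [Finset.mem_compl, Finset.mem_insert, Finset.mem_singleton, not_or]
        constructor
        · rintro ⟨h0, h1⟩
          obtain ⟨w, rfl⟩ := e.symm.surjective v
          rcases w with i | q
          · fin_cases i
            · exact absurd rfl h0
            · exact absurd rfl h1
          · exact ⟨q, rfl⟩
        · rintro ⟨q, rfl⟩
          exact ⟨fun h => by simpa using e.symm.injective h,
            fun h => by simpa using e.symm.injective h⟩
      · intro p q hpq
        exact (h _ _).2 hpq
  · rintro ⟨r, s, hrs, hs, hr, hT⟩
    obtain ⟨m, g, hg, hR, hadj⟩ := hT.exists_threeRings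
    have hne : ∀ q, g q ≠ r ∧ g q ≠ s := fun q => by simpa using (hR (g q)).2 ⟨q, rfl⟩
    obtain ⟨k, hks, hxr⟩ := exists_other hs
    obtain ⟨l, hlr, hxs⟩ := exists_other hr
    obtain ⟨t₀, rfl⟩ := (hR k).1 (by
      simp [hks, ne_of_mem_links (x := x) (i := r) (j := k) (by simp [hxr])])
    obtain ⟨t₁, rfl⟩ := (hR l).1 (by
      simp [hlr, ne_of_mem_links (x := x) (i := s) (j := l) (by simp [hxs])])
    refine ⟨m, ![t₀, t₁], isomorphic_of_bijective (Sum.elim ![r, s] g) ⟨?_, ?_⟩ ?_⟩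
    · refine Function.Injective.sumElim ?_ hg ?_
      · intro i j h
        fin_cases i <;> fin_cases j <;> simp_all
      · intro i q
        fin_cases i
        · exact (hne q).1.symm
        · exact (hne q).2.symm
    · intro v
      by_cases hv : v = r
      · exact ⟨.inl 0, by simp [hv]⟩
      by_cases hv' : v = s
      · exact ⟨.inl 1, by simp [hv']⟩
      obtain ⟨q, hq⟩ := (hR v).1 (by simp [hv, hv'])
      exact ⟨.inr q, hq⟩
    · have hsrc : ∀ q, r ∉ (x (g q)).1 ∧ s ∉ (x (g q)).1 := by
        intro q
        have h := fun k => hT.closed (k := k) ((hR (g q)).2 ⟨q, rfl⟩)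
        exact ⟨fun hk => by simpa using (h _ hk).1, fun hk => by simpa using (h _ hk).1⟩
      rintro (a | p) (b | q)
      · fin_cases a <;> fin_cases b <;>
          simp [Digraph.cliqueSource, hs, hr, notMem_links]
      · fin_cases a
        · simp [Digraph.cliqueSource, hxr, hne, hg.eq_iff]
        · simp [Digraph.cliqueSource, hxs, hne, hg.eq_iff]
      · fin_cases b <;> simp [Digraph.cliqueSource, hsrc]
      · simp [Digraph.cliqueSource, hadj]

/-! ### Triangles with a butterfly -/

theorem isThreeRingsWithButterfly_iff (x : Config₂ V) :
    (graph x).IsThreeRingsWithButterfly ↔ IsTrianglesWithButterfly x := by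
  constructor
  · rintro ⟨m, ⟨e⟩⟩
    have h := mem_links_iff_of_relIso e
    have hinj : ∀ a b : Fin 5, a ≠ b → e.symm (.inr a) ≠ e.symm (.inr b) := fun a b hab h =>
      hab (by simpa using e.symm.injective h)
    have hl : ∀ a b c : Fin 5, Digraph.butterfly.Adj a b → Digraph.butterfly.Adj a c → b ≠ c →
        (x (e.symm (.inr a))).1 = {e.symm (.inr b), e.symm (.inr c)} := fun a b c hab hac hbc =>
      links_eq_pair ((h _ _).2 (Sum.LiftRel.inr hab)) ((h _ _).2 (Sum.LiftRel.inr hac))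
        (hinj b c hbc)
    have hc := hl 0 1 3 (by simp [Digraph.butterfly]) (by simp [Digraph.butterfly]) (by decide)
    refine ⟨e.symm (.inr 0), e.symm (.inr 1), e.symm (.inr 2), e.symm (.inr 3), e.symm (.inr 4),
      ⟨?_, ?_, ?_, ?_, ?_, ?_, ?_, ?_, ?_, ?_⟩, hc⟩
    · exact hl 1 2 0 (by simp [Digraph.butterfly]) (by simp [Digraph.butterfly]) (by decide)
    · exact hl 2 1 0 (by simp [Digraph.butterfly]) (by simp [Digraph.butterfly]) (by decide)
    · exact hl 3 4 0 (by simp [Digraph.butterfly]) (by simp [Digraph.butterfly]) (by decide)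
    · exact hl 4 3 0 (by simp [Digraph.butterfly]) (by simp [Digraph.butterfly]) (by decide)
    · intro k hk
      rw [hc] at hk
      simp only [Finset.mem_insert, Finset.mem_singleton] at hk
      tauto
    · exact hinj _ _ (by decide)
    · exact hinj _ _ (by decide)
    · exact hinj _ _ (by decide)
    · exact hinj _ _ (by decide)
    · refine triangles_of_threeRings (m := m) (fun q => e.symm (.inl q)) ?_ ?_ ?_
      · intro p q hpq
        simpa using e.symm.injective hpq
      · intro v
        simp only [Finset.mem_compl, Finset.mem_insert, Finset.mem_singleton, not_or]
        constructor
        · rintro ⟨h0, h1, h2, h3, h4⟩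
          obtain ⟨w, rfl⟩ := e.symm.surjective v
          rcases w with q | i
          · exact ⟨q, rfl⟩
          · fin_cases i
            · exact absurd rfl h0
            · exact absurd rfl h1
            · exact absurd rfl h2
            · exact absurd rfl h3
            · exact absurd rfl h4
        · rintro ⟨q, rfl⟩
          refine ⟨?_, ?_, ?_, ?_, ?_⟩ <;> exact fun h => by simpa using e.symm.injective h
      · intro p q hpq
        exact (h _ _).2 (Sum.LiftRel.inl hpq)
  · rintro ⟨c, a, b, r, s, h, hc⟩
    obtain ⟨m, g, hg, hR, hadj⟩ := h.triangles.exists_threeRings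
    have hne : ∀ q, g q ≠ c ∧ g q ≠ a ∧ g q ≠ b ∧ g q ≠ r ∧ g q ≠ s := fun q => by
      simpa using (hR (g q)).2 ⟨q, rfl⟩
    have hsrc : ∀ q, c ∉ (x (g q)).1 ∧ a ∉ (x (g q)).1 ∧ b ∉ (x (g q)).1 ∧ r ∉ (x (g q)).1 ∧
        s ∉ (x (g q)).1 := by
      intro q
      have h := fun k => h.triangles.closed (k := k) ((hR (g q)).2 ⟨q, rfl⟩)
      refine ⟨?_, ?_, ?_, ?_, ?_⟩ <;> exact fun hk => by simpa using (h _ hk).1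
    have h1 := h.ne_ar
    have h2 := h.ne_as
    have h3 := h.ne_br
    have h4 := h.ne_bs
    have h5 := h.ne_ca
    have h6 := h.flip.ne_ca
    have h7 := h.swap.ne_ca
    have h8 := h.swap.flip.ne_ca
    have h9 := h.ne_ba
    have h10 := h.swap.ne_ba
    refine ⟨m, isomorphic_of_bijective (Sum.elim g ![c, a, b, r, s]) ⟨?_, ?_⟩ ?_⟩
    · refine hg.sumElim ?_ ?_
      · intro i j h
        fin_cases i <;> fin_cases j <;> simp_all
      · intro q i
        have := hne q
        fin_cases i <;> simp [this]
    · intro v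
      by_cases hv : v ∈ ({c, a, b, r, s} : Finset V)
      · simp only [Finset.mem_insert, Finset.mem_singleton] at hv
        rcases hv with rfl | rfl | rfl | rfl | rfl
        · exact ⟨.inr 0, rfl⟩
        · exact ⟨.inr 1, rfl⟩
        · exact ⟨.inr 2, rfl⟩
        · exact ⟨.inr 3, rfl⟩
        · exact ⟨.inr 4, rfl⟩
      · obtain ⟨q, hq⟩ := (hR v).1 (by simpa using hv)
        exact ⟨.inl q, hq⟩
    · rintro (p | i) (q | j)
      · simp [Digraph.disjointSum, hadj]
      · fin_cases j <;> simp [Digraph.disjointSum, hsrc]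
      · fin_cases i <;>
          simp [Digraph.disjointSum, hc, h.links_a, h.links_b, h.links_r, h.links_s, hne]
      · fin_cases i <;> fin_cases j <;>
          simp [Digraph.disjointSum, Digraph.butterfly, h.links_a, h.links_b, h.links_r,
            h.links_s, *, Ne.symm]

end

end CentralityGame

namespace CentralityGame

variable {V : Type*}

/-! ### Disjoint unions of rings -/

theorem isMutual_of_isRingUnion {x : Config₂ V} (h : (graph x).IsRingUnion) : IsMutual x := by
  obtain ⟨m, k, -, ⟨e⟩⟩ := h
  intro v u hu
  have huv : (Digraph.disjointUnion fun a => Digraph.ring (k a)).Adj (e v) (e u) :=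
    e.map_rel_iff.2 hu
  have : (Digraph.disjointUnion fun a => Digraph.ring (k a)).Adj (e u) (e v) := by
    generalize e u = p at huv ⊢
    generalize e v = q at huv ⊢
    obtain ⟨a, i, j, hij⟩ := huv
    exact Digraph.DisjointUnionAdj.mk (G := fun a => Digraph.ring (k a)) a j i
      (SimpleGraph.Adj.symm hij)
  exact e.map_rel_iff.1 this

/-- The undirected graph of an undirected configuration. -/
def IsMutual.simpleGraph {x : Config₂ V} (hx : IsMutual x) : SimpleGraph V where
  Adj u w := w ∈ (x u).1
  symm := ⟨fun u w h => hx u w h⟩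
  loopless := ⟨fun u h => notMem_links x u h⟩

theorem IsMutual.neighborSet {x : Config₂ V} (hx : IsMutual x) (v : V) :
    hx.simpleGraph.neighborSet v = ↑(x v).1 := rfl

variable [DecidableEq V] [Fintype V]

/-- The connected components of an undirected configuration are rings. -/
theorem IsMutual.exists_ring {x : Config₂ V} (hx : IsMutual x)
    (c : hx.simpleGraph.ConnectedComponent) :
    ∃ (k : ℕ) (f : Fin k → V), 3 ≤ k ∧ Function.Injective f ∧ (∀ v, v ∈ c.supp ↔ ∃ i, f i = v) ∧
      ∀ i j, (Digraph.ring k).Adj i j ↔ f j ∈ (x (f i)).1 := by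
  obtain ⟨v, hv⟩ := c.nonempty_supp
  -- Every node has exactly two neighbours, so a cycle runs through the whole component.
  have hcyc : hx.simpleGraph.IsCycles := fun u _ => by
    rw [hx.neighborSet, Set.ncard_coe_finset, card_links]
  have hne : (hx.simpleGraph.neighborSet v).Nonempty := by
    rw [hx.neighborSet]
    exact Finset.coe_nonempty.2 (Finset.card_pos.1 (by rw [card_links]; norm_num))
  obtain ⟨p, hp, hps⟩ := hcyc.exists_cycle_toSubgraph_verts_eq_connectedComponentSupp hv hne
  obtain ⟨n, hn⟩ : ∃ n, p.length = n + 3 := ⟨p.length - 3, by have := hp.three_le_length; omega⟩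
  let f : Fin (n + 3) → V := fun i => p.getVert i
  have hinj : Function.Injective f := by
    intro i j hij
    apply Fin.ext
    exact hp.getVert_injOn' (by simp; omega) (by simp; omega) hij
  have hsucc : ∀ i : Fin (n + 3), f (i + 1) ∈ (x (f i)).1 := by
    intro i
    have h : hx.simpleGraph.Adj (p.getVert i) (p.getVert (i + 1)) :=
      p.adj_getVert_succ (by omega)
    -- At the last index, `i + 1` wraps around to `0`, and the closed walk returns to its first
    -- node.
    have he : f (i + 1) = p.getVert (i + 1) := by
      simp only [f]
      by_cases hi : i = Fin.last (n + 2)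
      · subst hi
        simp only [Fin.last_add_one, Fin.val_last, Fin.val_zero, SimpleGraph.Walk.getVert_zero]
        rw [show n + 2 + 1 = p.length by omega, SimpleGraph.Walk.getVert_length]
      · rw [Fin.val_add_one_of_lt (Fin.lt_last_iff_ne_last.2 hi)]
    rw [he]
    exact h
  have hpred : ∀ i : Fin (n + 3), f (i - 1) ∈ (x (f i)).1 := by
    intro i
    have := hsucc (i - 1)
    rw [sub_add_cancel] at this
    exact hx _ _ this
  refine ⟨n + 3, f, by omega, hinj, ?_, ?_⟩
  · intro u
    rw [← hps, SimpleGraph.Walk.mem_verts_toSubgraph, SimpleGraph.Walk.mem_support_iff_exists_getVert]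
    constructor
    · rintro ⟨i, hi, hil⟩
      by_cases h : i = p.length
      · refine ⟨0, ?_⟩
        rw [← hi, h, SimpleGraph.Walk.getVert_length]
        simp [f]
      · exact ⟨⟨i, by omega⟩, hi⟩
    · rintro ⟨i, hi⟩
      exact ⟨i, hi, by omega⟩
  · intro i j
    -- The length is at least `3`, so successor and predecessor are distinct and exhaust the two
    -- links of `f i`.
    have hne : i + 1 ≠ i - 1 := by
      intro h
      have h2 : (1 : Fin (n + 3)) + 1 = 0 := by
        have : i + (1 + 1) = i + 0 := by rw [← add_assoc, h]; simp
        exact add_left_cancel this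
      have := congrArg Fin.val h2
      simp [Fin.val_add, Nat.mod_eq_of_lt (show 2 < n + 3 by omega)] at this
    rw [links_eq_pair (hsucc i) (hpred i) (fun h => hne (hinj h))]
    simp only [Finset.mem_insert, Finset.mem_singleton, hinj.eq_iff]
    change (SimpleGraph.cycleGraph (n + 3)).Adj i j ↔ _
    rw [SimpleGraph.cycleGraph_adj, or_comm]
    constructor
    · rintro (h | h)
      · left; rw [← h]; abel
      · right; rw [← h]; abel
    · rintro (rfl | rfl)
      · left; abel
      · right; abel

theorem isRingUnion_of_isMutual {x : Config₂ V} (hx : IsMutual x) : (graph x).IsRingUnion := by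
  classical
  choose k f hk hinj hsupp hadj using hx.exists_ring
  let E := Fintype.equivFin hx.simpleGraph.ConnectedComponent
  refine ⟨_, fun a => k (E.symm a), fun a => hk _, isomorphic_of_bijective
    (fun q => f (E.symm q.1) q.2) ⟨?_, ?_⟩ ?_⟩
  · rintro ⟨a, i⟩ ⟨b, j⟩ h
    simp only at h
    have ha := (hsupp (E.symm a) _).2 ⟨i, rfl⟩
    have hb := (hsupp (E.symm b) _).2 ⟨j, rfl⟩
    rw [h] at ha
    have hab : a = b := E.symm.injective (by
      rw [SimpleGraph.ConnectedComponent.mem_supp_iff] at ha hb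
      exact ha.symm.trans hb)
    subst hab
    rw [hinj _ h]
  · intro v
    obtain ⟨a, ha⟩ := E.symm.surjective (hx.simpleGraph.connectedComponentMk v)
    obtain ⟨i, hi⟩ := (hsupp (E.symm a) v).1 (by rw [ha]; rfl)
    exact ⟨⟨a, i⟩, hi⟩
  · rintro ⟨a, i⟩ ⟨b, j⟩
    constructor
    · rintro ⟨_, _, _, h⟩
      exact (hadj _ _ _).1 h
    · intro h
      simp only at h
      have ha := (hsupp (E.symm a) _).2 ⟨i, rfl⟩
      have hb := (hsupp (E.symm b) _).2 ⟨j, rfl⟩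
      rw [SimpleGraph.ConnectedComponent.mem_supp_iff] at ha hb
      have hab : a = b := E.symm.injective (by
        rw [← ha, ← hb]
        exact SimpleGraph.ConnectedComponent.connectedComponentMk_eq_of_adj h)
      subst hab
      exact Digraph.DisjointUnionAdj.mk (G := fun a => Digraph.ring (k (E.symm a))) a i j
        ((hadj _ _ _).2 h)

end CentralityGame

theorem mainTheorem6 {V : Type*} [Fintype V] [DecidableEq V]
    (β : ℝ) (hβ0 : 0 < β) (hβ1 : β < 1)
    (η : V → ℝ) (hη : ∀ i, 0 < η i) (hη1 : ∑ i, η i = 1)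
    (x : CentralityGame.Config (fun _ : V => 2)) :
    (Game.IsStrictNash (CentralityGame.utility (fun _ : V => 2) β η) x ↔
      (CentralityGame.graph x).IsRingUnion) ∧
    ((Game.IsNash (CentralityGame.utility (fun _ : V => 2) β η) x ∧
        Game.IsRecursive (CentralityGame.utility (fun _ : V => 2) β η) x) ↔
      (CentralityGame.graph x).IsRingUnion ∨
      (CentralityGame.graph x).IsThreeRingsWithCliqueSource ∨
      (CentralityGame.graph x).IsThreeRingsWithButterfly) := by
  have hring : (CentralityGame.graph x).IsRingUnion ↔ CentralityGame.IsMutual x :=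
    ⟨CentralityGame.isMutual_of_isRingUnion, CentralityGame.isRingUnion_of_isMutual⟩
  rw [hring, CentralityGame.isThreeRingsWithCliqueSource_iff,
    CentralityGame.isThreeRingsWithButterfly_iff]
  exact ⟨CentralityGame.isStrictNash_iff ⟨hβ0, hβ1⟩ hη x,
    CentralityGame.isNash_and_isRecursive_iff ⟨hβ0, hβ1⟩ hη x⟩
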